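/- Setting. Let $E$ be a Euclidean space with inner product $\langle\cdot,\cdot\rangle$, let $\|\cdot\|$ be an arbitrary norm on $E$ with unit ball $B=\{x:\|x\|\le 1\}$, and let $\|y\|_*=\max_{\|x\|\le 1}\langle x,y\rangle$ be the conjugate norm. Let $\omega$ be a distance-generating function compatible with $\|\cdot\|$: it is continuously differentiable on $B$, satisfies $\langle\nabla\omega(x)-\nabla\omega(y),x-y\rangle\ge\|x-y\|^2$ for all $x,y\in B$, and $\omega(0)=0$, $\nabla\omega(0)=0$. Put $\Omega=\max_{x\in B}\sqrt{2\omega(x)}$. Let $X\subset E$ be a nonempty convex compact set and let $R$ be the smallest radius of a $\|\cdot\|$-ball containing $X$. Let $P$ be a probability distribution on a measurable space $\Xi$ (for instance, $\Xi$ is the support of a Borel probability distribution on $\mathbf{R}^k$), let $m\ge 1$, and let $F_1,\dots,F_m:E\times\Xi\to\mathbf{R}$ be measurable functions such that each $F_i(x,\xi)$ is convex in $x\in E$ for every $\xi\in\Xi$ and $P$-integrable in $\xi$ for every $x\in E$. Put $f_i(x)=\int_\Xi F_i(x,\xi)\,P(d\xi)$ and assume that every $f_i$ is differentiable at every point of $X$.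 Put $$L(x,\xi)=\max_{1\le i\le m}\max\left\{\|g-h\|_*:\ g\in\partial_xF_i(x,\xi),\ h\in\partial f_i(x)\right\}$$ and assume that for some $M_1,M_2>0$ and all $x\in X$, $1\le i\le m$, $$\mathbf{E}_{\xi\sim P}\left[e^{(F_i(x,\xi)-f_i(x))^2/M_1^2}\right]\le e,\qquad \mathbf{E}_{\xi\sim P}\left[e^{L^2(x,\xi)/M_2^2}\right]\le e.$$ Let $\tau_*=0.557409\ldots$ be the smallest positive real such that $e^t\le t+e^{\tau_*t^2}$ for all $t\in\mathbf{R}$. Statement. Consider the minimax problem and its Sample Average Approximation $$\mathrm{Opt}=\min_{x\in X}\max_{1\le i\le m}f_i(x),\qquad \mathrm{Opt}_N(\xi^N)=\min_{x\in X}\max_{1\le i\le m}\frac1N\sum_{t=1}^NF_i(x,\xi_t),$$ where $\xi^N=(\xi_1,\dots,\xi_N)$ and $\xi_1,\dots,\xi_N$ are drawn independently from $P$. Then for every integer $N\ge 1$, every $s>1$ and all $\lambda,\mu\in[0,2\sqrt{\tau_*N}]$, $$\mathrm{Prob}\left\{\mathrm{Opt}_N(\xi^N)>\mathrm{Opt}+\frac{\mu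 M_1}{\sqrt N}\right\}\le m\,e^{-\mu^2/(4\tau_*)}$$ and $$\mathrm{Prob}\left\{\mathrm{Opt}_N(\xi^N)<\mathrm{Opt}-\frac{\mu M_1+2M_2R\left[\frac{\Omega}{2}(1+s^2)+2\lambda\right]}{\sqrt N}\right\}\le e^{-\mu^2/(4\tau_*)}+2\left[e^{-N(s^2-1)}+e^{-\lambda^2/(4\tau_*)}\right].$$ -/

import Mathlib

open MeasureTheory ProbabilityTheory Set

noncomputable section

namespace MinimaxSAA

/-- The smallest positive real `τ` such that `exp t ≤ t + exp (τ t²)` for all real `t`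
(the set below is closed from below and bounded away from `0`, so the infimum is attained). -/
def tauStar : ℝ :=
  sInf {τ : ℝ | 0 < τ ∧ ∀ t : ℝ, Real.exp t ≤ t + Real.exp (τ * t ^ 2)}

section Geometry

variable {E : Type*} [NormedAddCommGroup E] [InnerProductSpace ℝ E]

/-- The closed unit ball of the norm `p`. -/
def unitBall (p : Seminorm ℝ E) : Set E := {x | p x ≤ 1}

/-- The norm conjugate to `p` with respect to the inner product of `E`:
the maximum of `⟨x, y⟩` over `p x ≤ 1`. -/
def dualNorm (p : Seminorm ℝ E) (y : E) : ℝ :=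
  sSup ((fun x => inner ℝ x y) '' unitBall p)

/-- The subdifferential at `x` of a function `φ` on `E`. -/
def subdiff (φ : E → ℝ) (x : E) : Set E :=
  {g | ∀ y, φ x + inner ℝ g (y - x) ≤ φ y}

/-- `ω` is a distance-generating function for the unit ball of `p`, compatible with `p`:
continuously differentiable on the ball, strongly convex there with respect to `p` with
parameter one, and vanishing at the origin together with its gradient. -/
structure IsDistGen [CompleteSpace E] (p : Seminorm ℝ E) (ω : E → ℝ) : Prop where
  contDiffOn : ContDiffOn ℝ 1 ω (unitBall p)
  strongConvex : ∀ x ∈ unitBall p, ∀ y ∈ unitBall p,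
    p (x - y) ^ 2 ≤
      inner ℝ (gradientWithin ω (unitBall p) x - gradientWithin ω (unitBall p) y) (x - y)
  map_zero : ω 0 = 0
  gradient_zero : gradientWithin ω (unitBall p) 0 = 0

/-- `Ω`, the maximum of `√(2 ω(x))` over the unit ball of `p`. -/
def bigOmega (p : Seminorm ℝ E) (ω : E → ℝ) : ℝ :=
  sSup ((fun x => Real.sqrt (2 * ω x)) '' unitBall p)

/-- The smallest radius of a `p`-ball (with arbitrary center) containing `X`. -/
def circumradius (p : Seminorm ℝ E) (X : Set E) : ℝ :=
  sInf {r : ℝ | 0 ≤ r ∧ ∃ c : E, ∀ x ∈ X, p (x - c) ≤ r}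

end Geometry

/-- The optimal value of `min_{x ∈ X} max_i φ_i(x)`. -/
def minimaxValue {E : Type*} {m : ℕ} (X : Set E) (φ : Fin m → E → ℝ) : ℝ :=
  sInf ((fun x => ⨆ i, φ i x) '' X)

section Stochastic

variable {E Ξ : Type*} {m N : ℕ}

/-- The expectation functions `f_i(x) = ∫ F_i(x, ξ) P(dξ)`. -/
def expect [MeasurableSpace Ξ] (P : Measure Ξ) (F : Fin m → E → Ξ → ℝ) :
    Fin m → E → ℝ :=
  fun i x => ∫ ξ, F i x ξ ∂P

/-- The sample averages `f_{i,N}(x, ξ^N) = N⁻¹ ∑_t F_i(x, ξ_t)`. -/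
def sampleAvg (F : Fin m → E → Ξ → ℝ) (sample : Fin N → Ξ) : Fin m → E → ℝ :=
  fun i x => (N : ℝ)⁻¹ * ∑ t, F i x (sample t)

/-- `L(x, ξ)`, the maximum over `i`, over `g ∈ ∂_x F_i(x, ξ)` and over `h ∈ ∂ f_i(x)` of the
conjugate norm of `g - h`. -/
def subgradDev [NormedAddCommGroup E] [InnerProductSpace ℝ E] [MeasurableSpace Ξ]
    (p : Seminorm ℝ E) (P : Measure Ξ) (F : Fin m → E → Ξ → ℝ) (x : E) (ξ : Ξ) : ℝ :=
  sSup {r : ℝ | ∃ i, ∃ g ∈ subdiff (fun y => F i y ξ) x,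
    ∃ h ∈ subdiff (expect P F i) x, r = dualNorm p (g - h)}

end Stochastic

end MinimaxSAA

end

/-! The upper bound tests the sample problem at one minimiser `x` of the true problem: `Opt_N`
exceeds `Opt` by the stated margin only if one of the `m` sample means at `x` deviates from
`f_i(x)`, and a union bound gives the factor `m`.

For the lower bound, the minimax theorem supplies convex weights `w` with `Opt ≤ ∑ w_i f_i` on `X`,
so the same `x` minimises `∑ w_i f_i` over `X`. Let `G_i(ξ)` be measurable subgradients of `F_i(·,
ξ)` at `x`. Linearising each `∑ w_i F_i(·, ξ_t)` at `x` bounds the sample objective below by `Opt`,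
minus a scalar noise average, plus the pairing of `y - x` with `∑ w_i E[G_i]`, plus its pairing with
a centred noise vector. The first pairing is nonnegative by first-order optimality: the mean
subgradients are subgradients of differentiable functions, hence gradients. The second is at least
`-2R` times the conjugate norm of the noise. Aggregating with `w` before estimating leaves one
scalar and one vector deviation, so this side carries no factor `m`.

Scalar deviations follow from Chernoff's bound and the inequality defining `τ_*`. For the vector
sum, the convex conjugate `V` of `ω` on the unit ball is a smooth potential which, up to `Ω²/2`,
dominates the conjugate norm. Its growth along the partial sums is a scalar martingale plus half the
sum of squared conjugate norms, and each of these has exponential tails. -/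

namespace MinimaxSAA

/-! ### The constant `τ_*`. -/

theorem exp_le_add_exp_sq (t : ℝ) : Real.exp t ≤ t + Real.exp (t ^ 2) := by
  have h1 : 1 + t ^ 2 ≤ Real.exp (t ^ 2) := by linarith [Real.add_one_le_exp (t ^ 2)]
  rcases le_or_gt |t| 1 with h | h
  · have h2 := Real.abs_exp_sub_one_sub_id_le h
    linarith [(abs_le.1 h2).2]
  · rcases lt_abs.1 h with h | h
    · have : Real.exp t ≤ Real.exp (t ^ 2) := Real.exp_le_exp.2 (by nlinarith)
      linarith
    · have : Real.exp t ≤ 1 := Real.exp_le_one_iff.2 (by linarith)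
      nlinarith

/-- For each fixed `t` the condition on `τ` is closed, so it passes to the infimum; `τ = 1` shows
that the set is nonempty. -/
theorem exp_le_add_exp_tauStar (t : ℝ) :
    Real.exp t ≤ t + Real.exp (tauStar * t ^ 2) := by
  have hne : {τ : ℝ | 0 < τ ∧ ∀ t : ℝ, Real.exp t ≤ t + Real.exp (τ * t ^ 2)}.Nonempty :=
    ⟨1, one_pos, fun t => by simpa using exp_le_add_exp_sq t⟩
  have hbdd : BddBelow {τ : ℝ | 0 < τ ∧ ∀ t : ℝ, Real.exp t ≤ t + Real.exp (τ * t ^ 2)} :=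
    ⟨0, fun _ h => h.1.le⟩
  have hclosed : IsClosed {τ : ℝ | Real.exp t ≤ t + Real.exp (τ * t ^ 2)} :=
    isClosed_le continuous_const (by fun_prop)
  exact closure_minimal (fun τ h => h.2 t) hclosed (csInf_mem_closure hne hbdd)

theorem tauStar_pos : 0 < tauStar := by
  have h0 : 0 ≤ tauStar := Real.sInf_nonneg fun _ h => h.1.le
  refine h0.lt_of_ne fun h => ?_
  have h1 := exp_le_add_exp_tauStar 1
  rw [← h] at h1
  have h2 := Real.exp_one_gt_d9
  norm_num at h1
  linarith

/-! ### Exponential moments of a single increment. -/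

section Moments

variable {α : Type*} [MeasurableSpace α]

theorem integrable_of_lintegral_ofReal_ne_top {μ : Measure α} {f : α → ℝ} (hf : Measurable f)
    (h0 : ∀ a, 0 ≤ f a) (h : ∫⁻ a, ENNReal.ofReal (f a) ∂μ ≠ ⊤) : Integrable f μ :=
  (lintegral_ofReal_ne_top_iff_integrable hf.aestronglyMeasurable
    (Filter.Eventually.of_forall h0)).1 h

/-- Exponential moments of a centred variable whose square has a bounded exponential moment. -/
theorem lintegral_exp_mul_le {P : Measure α} [IsProbabilityMeasure P] {h : α → ℝ}
    (hm : Measurable h) (hi : Integrable h P) (h0 : ∫ a, h a ∂P = 0) {M : ℝ} (hM : 0 < M)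
    (hexp : ∫⁻ a, ENNReal.ofReal (Real.exp (h a ^ 2 / M ^ 2)) ∂P ≤ ENNReal.ofReal (Real.exp 1))
    {θ : ℝ} (hθ : tauStar * θ ^ 2 * M ^ 2 ≤ 1) :
    ∫⁻ a, ENNReal.ofReal (Real.exp (θ * h a)) ∂P
      ≤ ENNReal.ofReal (Real.exp (tauStar * θ ^ 2 * M ^ 2)) := by
  set b := tauStar * θ ^ 2 * M ^ 2 with hb
  have hb0 : 0 ≤ b := by have := tauStar_pos; positivity
  have hqm : Measurable fun a => Real.exp (h a ^ 2 / M ^ 2) := by fun_prop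
  have hqi : Integrable (fun a => Real.exp (h a ^ 2 / M ^ 2)) P :=
    integrable_of_lintegral_ofReal_ne_top hqm (fun _ => (Real.exp_pos _).le)
      (ne_top_of_le_ne_top ENNReal.ofReal_ne_top hexp)
  have hqe : ∫ a, Real.exp (h a ^ 2 / M ^ 2) ∂P ≤ Real.exp 1 := by
    rw [← ofReal_integral_eq_lintegral_ofReal hqi
      (Filter.Eventually.of_forall fun _ => (Real.exp_pos _).le)] at hexp
    exact (ENNReal.ofReal_le_ofReal_iff (Real.exp_pos _).le).1 hexp
  have key : ∀ a, Real.exp (θ * h a) ≤ θ * h a + (Real.exp b * (1 - b)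
      + Real.exp b * b * Real.exp (-1) * Real.exp (h a ^ 2 / M ^ 2)) := by
    intro a
    have e1 := exp_le_add_exp_tauStar (θ * h a)
    set q := h a ^ 2 / M ^ 2 with hq
    have e2 : tauStar * (θ * h a) ^ 2 = b + b * (q - 1) := by
      rw [hq, hb]; field_simp; ring
    have e3 : Real.exp (b * (q - 1)) ≤ (1 - b) + b * Real.exp (q - 1) := by
      have := convexOn_exp.2 (mem_univ 0) (mem_univ (q - 1)) (sub_nonneg.2 hθ) hb0 (by ring)
      simpa using this
    have e4 : Real.exp (q - 1) = Real.exp (-1) * Real.exp q := by rw [← Real.exp_add]; ring_nf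
    rw [e2, Real.exp_add] at e1
    rw [e4] at e3
    have := mul_le_mul_of_nonneg_left e3 (Real.exp_pos b).le
    linarith
  have hsi : Integrable (fun a => Real.exp b * (1 - b)
      + Real.exp b * b * Real.exp (-1) * Real.exp (h a ^ 2 / M ^ 2)) P :=
    (integrable_const _).add (hqi.const_mul _)
  have hri : Integrable (fun a => θ * h a + (Real.exp b * (1 - b)
      + Real.exp b * b * Real.exp (-1) * Real.exp (h a ^ 2 / M ^ 2))) P :=
    (hi.const_mul θ).add hsi
  calc ∫⁻ a, ENNReal.ofReal (Real.exp (θ * h a)) ∂P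
      ≤ ∫⁻ a, ENNReal.ofReal (θ * h a + (Real.exp b * (1 - b)
      + Real.exp b * b * Real.exp (-1) * Real.exp (h a ^ 2 / M ^ 2))) ∂P :=
        lintegral_mono fun a => ENNReal.ofReal_le_ofReal (key a)
    _ = ENNReal.ofReal (∫ a, (θ * h a + (Real.exp b * (1 - b)
      + Real.exp b * b * Real.exp (-1) * Real.exp (h a ^ 2 / M ^ 2))) ∂P) :=
        (ofReal_integral_eq_lintegral_ofReal hri (Filter.Eventually.of_forall fun a =>
          (Real.exp_pos _).le.trans (key a))).symm
    _ ≤ ENNReal.ofReal (Real.exp b) := by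
        apply ENNReal.ofReal_le_ofReal
        rw [integral_add (hi.const_mul θ) hsi,
          integral_add (integrable_const _) (hqi.const_mul _), integral_const, integral_const_mul,
          integral_const_mul, h0]
        simp only [probReal_univ, one_smul, mul_zero, zero_add]
        have e5 : Real.exp b * b * Real.exp (-1) * ∫ a, Real.exp (h a ^ 2 / M ^ 2) ∂P
            ≤ Real.exp b * b * Real.exp (-1) * Real.exp 1 :=
          mul_le_mul_of_nonneg_left hqe (by positivity)
        have e6 : Real.exp (-1) * Real.exp 1 = 1 := by rw [← Real.exp_add]; simp
        rw [mul_assoc (Real.exp b * b) _ (Real.exp 1), e6] at e5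
        linarith

theorem measure_ge_le_of_exp_moment {μ : Measure α} {W : α → ℝ} {θ c K : ℝ} (hW : Measurable W)
    (hθ : 0 ≤ θ)
    (hK : ∫⁻ a, ENNReal.ofReal (Real.exp (θ * W a)) ∂μ ≤ ENNReal.ofReal (Real.exp K)) :
    μ {a | c ≤ W a} ≤ ENNReal.ofReal (Real.exp (K - θ * c)) := by
  have hsub : {a | c ≤ W a} ⊆
      {a | ENNReal.ofReal (Real.exp (θ * c)) ≤ ENNReal.ofReal (Real.exp (θ * W a))} := by
    intro a ha
    exact ENNReal.ofReal_le_ofReal (Real.exp_le_exp.2 (mul_le_mul_of_nonneg_left ha hθ))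
  have hpos : ENNReal.ofReal (Real.exp (θ * c)) ≠ 0 := by
    simpa using Real.exp_pos _
  calc μ {a | c ≤ W a} ≤ _ := measure_mono hsub
    _ ≤ (∫⁻ a, ENNReal.ofReal (Real.exp (θ * W a)) ∂μ) / ENNReal.ofReal (Real.exp (θ * c)) :=
      meas_ge_le_lintegral_div (by fun_prop) hpos ENNReal.ofReal_ne_top
    _ ≤ ENNReal.ofReal (Real.exp K) / ENNReal.ofReal (Real.exp (θ * c)) := by gcongr
    _ = _ := by rw [← ENNReal.ofReal_div_of_pos (Real.exp_pos _), Real.exp_sub]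

end Moments

/-! ### Chernoff bounds along state-dependent trajectories. -/

section PathSum

variable {σ Ξ : Type*}

/-- The sum of the rewards `h S_t ξ_t` along the trajectory `S_{t+1} = u S_t ξ_t` started at `S`. -/
def pathSum (h : σ → Ξ → ℝ) (u : σ → Ξ → σ) : (n : ℕ) → σ → (Fin n → Ξ) → ℝ
  | 0, _, _ => 0
  | n + 1, S, ξ => h S (ξ 0) + pathSum h u n (u S (ξ 0)) (Fin.tail ξ)

theorem pathSum_of_forall_eq (g : Ξ → ℝ) (u : σ → Ξ → σ) (n : ℕ) (S : σ) (ξ : Fin n → Ξ) :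
    pathSum (fun _ => g) u n S ξ = ∑ t, g (ξ t) := by
  induction n generalizing S with
  | zero => simp [pathSum]
  | succ n ih => rw [pathSum, ih, Fin.sum_univ_succ]; rfl

theorem pathSum_const_mul (θ : ℝ) (h : σ → Ξ → ℝ) (u : σ → Ξ → σ) (n : ℕ) (S : σ)
    (ξ : Fin n → Ξ) :
    pathSum (fun S x => θ * h S x) u n S ξ = θ * pathSum h u n S ξ := by
  induction n generalizing S with
  | zero => simp [pathSum]
  | succ n ih => rw [pathSum, ih, pathSum, mul_add]

variable [MeasurableSpace σ] [MeasurableSpace Ξ]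

theorem measurable_pathSum {h : σ → Ξ → ℝ} {u : σ → Ξ → σ}
    (hh : Measurable (Function.uncurry h)) (hu : Measurable (Function.uncurry u)) (n : ℕ) :
    Measurable fun z : σ × (Fin n → Ξ) => pathSum h u n z.1 z.2 := by
  induction n with
  | zero => simp only [pathSum]; fun_prop
  | succ n ih =>
    simp only [pathSum]
    have h1 : Measurable fun z : σ × (Fin (n + 1) → Ξ) => (z.1, z.2 0) := by fun_prop
    have h2 : Measurable fun z : σ × (Fin (n + 1) → Ξ) => (Fin.tail z.2 : Fin n → Ξ) := by
      unfold Fin.tail; fun_prop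
    exact (hh.comp h1).add (ih.comp ((hu.comp h1).prodMk h2))

/-- Fubini splits off the first sample; what remains is a shorter trajectory from another state. As
the one-step bound is uniform in the state, induction over all starting states replaces conditioning
on a filtration. -/
theorem lintegral_exp_pathSum_le (P : Measure Ξ) [IsProbabilityMeasure P] {h : σ → Ξ → ℝ}
    {u : σ → Ξ → σ} (hh : Measurable (Function.uncurry h)) (hu : Measurable (Function.uncurry u))
    {K : ℝ} (hK : ∀ S, ∫⁻ x, ENNReal.ofReal (Real.exp (h S x)) ∂P ≤ ENNReal.ofReal (Real.exp K))
    (n : ℕ) (S : σ) :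
    ∫⁻ ξ, ENNReal.ofReal (Real.exp (pathSum h u n S ξ)) ∂(Measure.pi fun _ : Fin n => P)
      ≤ ENNReal.ofReal (Real.exp (n * K)) := by
  induction n generalizing S with
  | zero => simp [pathSum]
  | succ n ih =>
    have hmp := (measurePreserving_piFinSuccAbove (fun _ : Fin (n + 1) => P) 0).symm
    rw [← hmp.lintegral_comp_emb (MeasurableEquiv.measurableEmbedding _)]
    have hcomp : ∀ z : Ξ × (Fin n → Ξ), ENNReal.ofReal (Real.exp (pathSum h u (n + 1) S
        ((MeasurableEquiv.piFinSuccAbove (fun _ : Fin (n + 1) => Ξ) 0).symm z)))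
        = ENNReal.ofReal (Real.exp (h S z.1)) *
          ENNReal.ofReal (Real.exp (pathSum h u n (u S z.1) z.2)) := by
      intro z
      rw [← ENNReal.ofReal_mul (Real.exp_pos _).le, ← Real.exp_add, pathSum]
      simp [MeasurableEquiv.piFinSuccAbove, Fin.insertNthEquiv]
    simp_rw [hcomp]
    have m1 : Measurable fun z : Ξ × (Fin n → Ξ) => pathSum h u n (u S z.1) z.2 := by
      have h3 : Measurable fun z : Ξ × (Fin n → Ξ) => u S z.1 :=
        hu.comp (measurable_const.prodMk measurable_fst)
      exact (measurable_pathSum hh hu n).comp (h3.prodMk measurable_snd)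
    have m2 : Measurable (h S) := hh.comp (measurable_const.prodMk measurable_id)
    rw [lintegral_prod _ (by fun_prop)]
    calc _ ≤ ∫⁻ x, ENNReal.ofReal (Real.exp (h S x)) * ENNReal.ofReal (Real.exp (n * K)) ∂P := by
          apply lintegral_mono
          intro x
          have m3 : Measurable fun y : Fin n → Ξ => pathSum h u n (u S x) y :=
            m1.comp (measurable_const.prodMk measurable_id)
          simp only
          rw [lintegral_const_mul _ (by fun_prop)]
          gcongr
          exact ih _
      _ ≤ ENNReal.ofReal (Real.exp K) * ENNReal.ofReal (Real.exp (n * K)) := by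
          rw [lintegral_mul_const _ (by fun_prop)]
          gcongr
          exact hK S
      _ = _ := by
          rw [← ENNReal.ofReal_mul (Real.exp_pos _).le, ← Real.exp_add]
          push_cast
          ring_nf

/-- Chernoff's bound for the sum of the rewards along a trajectory. -/
theorem measure_pathSum_ge_le (P : Measure Ξ) [IsProbabilityMeasure P] {h : σ → Ξ → ℝ}
    {u : σ → Ξ → σ} (hh : Measurable (Function.uncurry h)) (hu : Measurable (Function.uncurry u))
    {θ K c : ℝ} (hθ : 0 ≤ θ)
    (hK : ∀ S, ∫⁻ x, ENNReal.ofReal (Real.exp (θ * h S x)) ∂P ≤ ENNReal.ofReal (Real.exp K))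
    (n : ℕ) (S : σ) :
    (Measure.pi fun _ : Fin n => P) {ξ | c ≤ pathSum h u n S ξ}
      ≤ ENNReal.ofReal (Real.exp (n * K - θ * c)) := by
  have hm : Measurable fun ξ : Fin n → Ξ => pathSum h u n S ξ :=
    (measurable_pathSum hh hu n).comp (measurable_const.prodMk measurable_id)
  refine measure_ge_le_of_exp_moment hm hθ ?_
  have hh' : Measurable (Function.uncurry fun S x => θ * h S x) := hh.const_mul θ
  simpa only [pathSum_const_mul] using lintegral_exp_pathSum_le P hh' hu hK n S

/-- Tail bound for a martingale with increments `h S_t ξ_t`, from a bounded exponential moment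
of the squared increments. -/
theorem measure_pathSum_ge_le_of_sq (P : Measure Ξ) [IsProbabilityMeasure P] {h : σ → Ξ → ℝ}
    {u : σ → Ξ → σ} (hh : Measurable (Function.uncurry h)) (hu : Measurable (Function.uncurry u))
    (hi : ∀ S, Integrable (h S) P) (h0 : ∀ S, ∫ x, h S x ∂P = 0) {M : ℝ} (hM : 0 < M)
    (hexp : ∀ S, ∫⁻ x, ENNReal.ofReal (Real.exp (h S x ^ 2 / M ^ 2)) ∂P
      ≤ ENNReal.ofReal (Real.exp 1))
    {n : ℕ} (hn : 1 ≤ n) {lam : ℝ} (hlam : lam ∈ Icc 0 (2 * Real.sqrt (tauStar * n))) (S : σ) :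
    (Measure.pi fun _ : Fin n => P) {ξ | lam * M * Real.sqrt n ≤ pathSum h u n S ξ}
      ≤ ENNReal.ofReal (Real.exp (-(lam ^ 2 / (4 * tauStar)))) := by
  have hτ := tauStar_pos
  have hn0 : (0 : ℝ) < n := by exact_mod_cast hn
  have hs0 : 0 < Real.sqrt n := Real.sqrt_pos.2 hn0
  have hs2 : Real.sqrt n ^ 2 = n := Real.sq_sqrt hn0.le
  have hl0 := hlam.1
  have hl2 : lam ^ 2 ≤ 4 * (tauStar * n) := by
    have h4 := pow_le_pow_left₀ hl0 hlam.2 2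
    rw [mul_pow, Real.sq_sqrt (by positivity)] at h4
    linarith
  -- This `θ` minimises the exponent `n τ_* θ² M² - θ lam M √n`. The admissible range of `lam` is
  -- exactly what keeps `τ_* θ² M² ≤ 1`.
  set θ := lam / (2 * tauStar * Real.sqrt n * M) with hθdef
  have hb : tauStar * θ ^ 2 * M ^ 2 = lam ^ 2 / (4 * tauStar * n) := by
    rw [hθdef, div_pow, mul_pow, mul_pow, mul_pow, hs2]; field_simp; ring
  have hb1 : tauStar * θ ^ 2 * M ^ 2 ≤ 1 := by
    rw [hb, div_le_one (by positivity)]; linarith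
  have := measure_pathSum_ge_le P hh hu (θ := θ) (c := lam * M * Real.sqrt n) (by positivity)
    (fun S => lintegral_exp_mul_le (hh.comp (measurable_const.prodMk measurable_id))
      (hi S) (h0 S) hM (hexp S) hb1) n S
  refine this.trans (le_of_eq ?_)
  congr 2
  rw [hb, hθdef]
  field_simp
  ring

end PathSum

/-! ### The norm `p` and its conjugate in finite dimension. -/

section Norms

variable {E : Type*} [NormedAddCommGroup E] [InnerProductSpace ℝ E]

theorem zero_mem_unitBall (p : Seminorm ℝ E) : (0 : E) ∈ unitBall p := by
  simp [unitBall]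

theorem convex_unitBall (p : Seminorm ℝ E) : Convex ℝ (unitBall p) := by
  have : unitBall p = p.closedBall 0 1 := by ext x; simp [unitBall, Seminorm.mem_closedBall]
  rw [this]
  exact p.convex_closedBall 0 1

theorem dualNorm_le_of_forall {p : Seminorm ℝ E} {y : E} {c : ℝ}
    (h : ∀ x, p x ≤ 1 → inner ℝ x y ≤ c) : dualNorm p y ≤ c :=
  csSup_le (Set.Nonempty.image _ ⟨0, zero_mem_unitBall p⟩)
    (forall_mem_image.2 fun x hx => h x hx)

variable [FiniteDimensional ℝ E]

theorem continuous_of_convexOn_univ {f : E → ℝ} (hf : ConvexOn ℝ univ f) : Continuous f :=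
  hf.locallyLipschitz.continuous

theorem continuous_seminorm (p : Seminorm ℝ E) : Continuous p :=
  continuous_of_convexOn_univ p.convexOn

variable {p : Seminorm ℝ E} (hp : ∀ x, p x = 0 → x = 0)

include hp

/-- The constant is the minimum of `p` over the Euclidean unit sphere, positive by definiteness. It
makes the `p`-ball compact. -/
theorem exists_mul_norm_le_seminorm : ∃ c > 0, ∀ x, c * ‖x‖ ≤ p x := by
  rcases subsingleton_or_nontrivial E with hE | hE
  · exact ⟨1, one_pos, fun x => by rw [Subsingleton.elim x 0]; simp⟩
  have hne : (Metric.sphere (0 : E) 1).Nonempty := NormedSpace.sphere_nonempty.2 zero_le_one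
  obtain ⟨z, hz, hmin⟩ :=
    (isCompact_sphere (0 : E) 1).exists_isMinOn hne (continuous_seminorm p).continuousOn
  have hz1 : ‖z‖ = 1 := by simpa using hz
  refine ⟨p z, (apply_nonneg p z).lt_of_ne fun h => ?_, fun x => ?_⟩
  · rw [hp z h.symm, norm_zero] at hz1
    exact zero_ne_one hz1
  · rcases eq_or_ne x 0 with rfl | hx
    · simp
    have hx0 : 0 < ‖x‖ := norm_pos_iff.2 hx
    have h1 : p z ≤ p (‖x‖⁻¹ • x) := hmin (by simp [norm_smul, hx0.ne'])
    rw [map_smul_eq_mul, norm_inv, norm_norm, inv_mul_eq_div, le_div_iff₀ hx0] at h1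
    exact h1

theorem isCompact_unitBall : IsCompact (unitBall p) := by
  obtain ⟨c, hc, h⟩ := exists_mul_norm_le_seminorm hp
  refine (isCompact_closedBall (0 : E) c⁻¹).of_isClosed_subset
    (isClosed_le (continuous_seminorm p) continuous_const) fun x hx => ?_
  rw [mem_closedBall_zero_iff, ← one_div, le_div_iff₀ hc, mul_comm]
  exact (h x).trans hx

theorem bddAbove_inner_unitBall (y : E) :
    BddAbove ((fun x => inner ℝ x y) '' unitBall p) :=
  ((isCompact_unitBall hp).image (by fun_prop)).bddAbove

theorem inner_le_dualNorm {x : E} (hx : p x ≤ 1) (y : E) : inner ℝ x y ≤ dualNorm p y :=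
  le_csSup (bddAbove_inner_unitBall hp y) (mem_image_of_mem _ hx)

theorem dualNorm_nonneg (y : E) : 0 ≤ dualNorm p y := by
  simpa using inner_le_dualNorm hp (zero_mem_unitBall p) y

theorem inner_le_mul_dualNorm (x y : E) : inner ℝ x y ≤ p x * dualNorm p y := by
  rcases (apply_nonneg p x).eq_or_lt with h | h
  · rw [hp x h.symm]; simp
  · have h1 : p ((p x)⁻¹ • x) ≤ 1 := by
      rw [map_smul_eq_mul, norm_inv, Real.norm_of_nonneg h.le, inv_mul_cancel₀ h.ne']
    have := inner_le_dualNorm hp h1 y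
    rw [real_inner_smul_left, inv_mul_eq_div, div_le_iff₀ h] at this
    linarith

theorem sq_inner_le_sq_dualNorm {x : E} (hx : p x ≤ 1) (y : E) :
    inner ℝ y x ^ 2 ≤ dualNorm p y ^ 2 := by
  rw [real_inner_comm]
  have h2 := inner_le_dualNorm hp (x := -x) (by simpa using hx) y
  rw [inner_neg_left] at h2
  exact sq_le_sq' (by linarith) (inner_le_dualNorm hp hx y)

theorem dualNorm_add_le (y z : E) : dualNorm p (y + z) ≤ dualNorm p y + dualNorm p z :=
  dualNorm_le_of_forall fun x hx => by
    rw [inner_add_right]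
    exact add_le_add (inner_le_dualNorm hp hx y) (inner_le_dualNorm hp hx z)

theorem dualNorm_smul_le {c : ℝ} (hc : 0 ≤ c) (y : E) : dualNorm p (c • y) ≤ c * dualNorm p y :=
  dualNorm_le_of_forall fun x hx => by
    rw [real_inner_smul_right]
    exact mul_le_mul_of_nonneg_left (inner_le_dualNorm hp hx y) hc

theorem dualNorm_smul {c : ℝ} (hc : 0 ≤ c) (y : E) : dualNorm p (c • y) = c * dualNorm p y := by
  refine (dualNorm_smul_le hp hc y).antisymm ?_
  rcases hc.eq_or_lt with rfl | hc
  · simpa using dualNorm_nonneg hp (0 : E)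
  · have := dualNorm_smul_le hp (inv_nonneg.2 hc.le) (c • y)
    rw [inv_smul_smul₀ hc.ne', inv_mul_eq_div, le_div_iff₀ hc] at this
    linarith

theorem dualNorm_sum_le {ι : Type*} (s : Finset ι) (w : ι → ℝ) (hw : ∀ i, 0 ≤ w i) (y : ι → E) :
    dualNorm p (∑ i ∈ s, w i • y i) ≤ ∑ i ∈ s, w i * dualNorm p (y i) :=
  dualNorm_le_of_forall fun x hx => by
    rw [inner_sum]
    refine Finset.sum_le_sum fun i _ => ?_
    rw [real_inner_smul_right]
    exact mul_le_mul_of_nonneg_left (inner_le_dualNorm hp hx _) (hw i)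

theorem continuous_dualNorm : Continuous (dualNorm p) := by
  refine continuous_of_convexOn_univ ⟨convex_univ, fun x _ y _ a b ha hb _ => ?_⟩
  simpa only [dualNorm_smul hp ha, dualNorm_smul hp hb, smul_eq_mul] using
    dualNorm_add_le hp (a • x) (b • y)

end Norms

/-! ### Dual averaging and large deviations of vector sums. -/

section DualAveraging

variable {E : Type*} [NormedAddCommGroup E] [InnerProductSpace ℝ E] [FiniteDimensional ℝ E]
  {p : Seminorm ℝ E} {ω : E → ℝ}

theorem IsDistGen.hasFDerivWithinAt (hω : IsDistGen p ω) {x : E} (hx : x ∈ unitBall p) :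
    HasFDerivWithinAt ω (InnerProductSpace.toDual ℝ E (gradientWithin ω (unitBall p) x))
      (unitBall p) x :=
  ((hω.contDiffOn.differentiableOn one_ne_zero) x hx).hasGradientWithinAt.hasFDerivWithinAt

/-- Strong monotonicity of the gradient is integrated along the segment: `φ`, which is `ω` minus its
linearisation and the quadratic term, has nonnegative derivative on the interior. -/
theorem IsDistGen.le_of_mem (hω : IsDistGen p ω) {x y : E} (hx : x ∈ unitBall p)
    (hy : y ∈ unitBall p) :
    ω x + inner ℝ (gradientWithin ω (unitBall p) x) (y - x) + p (y - x) ^ 2 / 2 ≤ ω y := by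
  set g := gradientWithin ω (unitBall p) with hg
  set d := y - x with hd
  have hmem : ∀ t ∈ Icc (0 : ℝ) 1, x + t • d ∈ unitBall p := fun t ht =>
    (convex_unitBall p).add_smul_sub_mem hx hy ht
  set φ : ℝ → ℝ := fun t => ω (x + t • d) - t * inner ℝ (g x) d - t ^ 2 * (p d ^ 2 / 2) with hφ
  have hder : ∀ t ∈ Icc (0 : ℝ) 1, HasDerivWithinAt φ
      (inner ℝ (g (x + t • d)) d - inner ℝ (g x) d - 2 * t * (p d ^ 2 / 2)) (Icc 0 1) t := by
    intro t ht
    have h1 : HasDerivWithinAt (fun t : ℝ => x + t • d) d (Icc 0 1) t := by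
      simpa using (((hasDerivAt_id t).smul_const d).const_add x).hasDerivWithinAt
    have h2 := (hω.hasFDerivWithinAt (hmem t ht)).comp_hasDerivWithinAt t h1 hmem
    have h3 : HasDerivWithinAt (fun t : ℝ => t * inner ℝ (g x) d) (inner ℝ (g x) d) (Icc 0 1) t := by
      simpa using ((hasDerivAt_id t).mul_const (inner ℝ (g x) d)).hasDerivWithinAt
    have h4 : HasDerivWithinAt (fun t : ℝ => t ^ 2 * (p d ^ 2 / 2)) (2 * t * (p d ^ 2 / 2))
        (Icc 0 1) t := by
      simpa using ((hasDerivAt_pow 2 t).mul_const (p d ^ 2 / 2)).hasDerivWithinAt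
    exact (h2.sub h3).sub h4
  have hmono : MonotoneOn φ (Icc 0 1) := by
    refine monotoneOn_of_deriv_nonneg (convex_Icc 0 1)
      (fun t ht => (hder t ht).continuousWithinAt) ?_ ?_
    · intro t ht
      exact ((hder t (interior_subset ht)).differentiableWithinAt).mono interior_subset
    · intro t ht
      have hda := (hder t (interior_subset ht)).hasDerivAt (mem_interior_iff_mem_nhds.1 ht)
      rw [hda.deriv]
      rw [interior_Icc] at ht
      -- Both sides of this inequality carry a factor `t > 0`, cancelled below.
      have hsc := hω.strongConvex _ (hmem t (Ioo_subset_Icc_self ht)) x hx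
      rw [add_sub_cancel_left, map_smul_eq_mul, Real.norm_of_nonneg ht.1.le, inner_sub_left,
        real_inner_smul_right, real_inner_smul_right, ← mul_sub, mul_pow, sq t, mul_assoc] at hsc
      have := le_of_mul_le_mul_left hsc ht.1
      linarith
  have h01 := hmono (left_mem_Icc.2 zero_le_one) (right_mem_Icc.2 zero_le_one) zero_le_one
  simp only [hφ, hd, zero_smul, add_zero, one_smul, add_sub_cancel] at h01
  simp only [hd]
  linarith

theorem IsDistGen.half_sq_le (hω : IsDistGen p ω) {x : E} (hx : x ∈ unitBall p) :
    p x ^ 2 / 2 ≤ ω x := by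
  have := hω.le_of_mem (zero_mem_unitBall p) hx
  simpa [hω.map_zero, hω.gradient_zero] using this

variable (hp : ∀ x, p x = 0 → x = 0)

include hp

theorem IsDistGen.le_half_bigOmega_sq (hω : IsDistGen p ω) {x : E} (hx : x ∈ unitBall p) :
    ω x ≤ bigOmega p ω ^ 2 / 2 := by
  have h0 : 0 ≤ ω x := le_trans (by positivity) (hω.half_sq_le hx)
  have hbdd : BddAbove ((fun x => Real.sqrt (2 * ω x)) '' unitBall p) :=
    ((isCompact_unitBall hp).image_of_continuousOn
      (hω.contDiffOn.continuousOn.const_mul 2 |>.sqrt)).bddAbove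
  have h1 : Real.sqrt (2 * ω x) ≤ bigOmega p ω := le_csSup hbdd (mem_image_of_mem _ hx)
  have h2 := pow_le_pow_left₀ (Real.sqrt_nonneg _) h1 2
  rw [Real.sq_sqrt (by positivity)] at h2
  linarith

omit [FiniteDimensional ℝ E] hp in
theorem bigOmega_nonneg : 0 ≤ bigOmega p ω :=
  Real.sSup_nonneg (forall_mem_image.2 fun _ _ => Real.sqrt_nonneg _)

/-- A vector with `p x = 1` has `ω x ≥ 1/2`. Positivity makes the step size in the deviation bound
nonzero. -/
theorem IsDistGen.bigOmega_pos [Nontrivial E] (hω : IsDistGen p ω) : 0 < bigOmega p ω := by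
  obtain ⟨x, hx⟩ := exists_ne (0 : E)
  have hpx : 0 < p x := (apply_nonneg p x).lt_of_ne fun h => hx (hp x h.symm)
  have h1 : p ((p x)⁻¹ • x) = 1 := by
    rw [map_smul_eq_mul, norm_inv, Real.norm_of_nonneg hpx.le, inv_mul_cancel₀ hpx.ne']
  have hmem : (p x)⁻¹ • x ∈ unitBall p := h1.le
  have h2 := hω.half_sq_le hmem
  have h3 := hω.le_half_bigOmega_sq hp hmem
  rw [h1] at h2
  have h4 := bigOmega_nonneg (p := p) (ω := ω)
  refine h4.lt_of_ne fun h => ?_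
  rw [← h] at h3
  linarith

/-- The strong maximality of a maximiser of `⟨S, ·⟩ - ω` over the unit ball. -/
theorem IsDistGen.exists_strong_max (hω : IsDistGen p ω) (S : E) :
    ∃ x ∈ unitBall p, ∀ y ∈ unitBall p,
      inner ℝ S y - ω y ≤ inner ℝ S x - ω x - p (y - x) ^ 2 / 2 := by
  obtain ⟨x, hx, hmax⟩ := (isCompact_unitBall hp).exists_isMaxOn ⟨0, zero_mem_unitBall p⟩
    (f := fun y => inner ℝ S y - ω y)
    ((continuous_const.inner continuous_id).continuousOn.sub hω.contDiffOn.continuousOn)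
  refine ⟨x, hx, fun y hy => ?_⟩
  have hder := ((innerSL ℝ S).hasFDerivAt (x := x)).hasFDerivWithinAt.sub
    (hω.hasFDerivWithinAt hx)
  have hcone : y - x ∈ posTangentConeAt (unitBall p) x :=
    sub_mem_posTangentConeAt_of_segment_subset ((convex_unitBall p).segment_subset hx hy)
  -- First-order optimality of `x` towards `y`; adding the strong convexity inequality for `ω`
  -- yields the quadratic gain.
  have h1 := hmax.localize.hasFDerivWithinAt_nonpos hder hcone
  have h2 := hω.le_of_mem hx hy
  simp only [sub_apply, innerSL_apply_apply,
    InnerProductSpace.toDual_apply_apply, inner_sub_right] at h1 h2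
  linarith

/-- The dual averaging map `x` and its potential `V`, the convex conjugate of the
distance-generating function restricted to the unit ball. -/
theorem IsDistGen.exists_dual_averaging (hω : IsDistGen p ω) :
    ∃ (x : E → E) (V : E → ℝ), Continuous x ∧ (∀ S, p (x S) ≤ 1) ∧ V 0 ≤ 0 ∧
      (∀ S D, V (S + D) ≤ V S + inner ℝ D (x S) + dualNorm p D ^ 2 / 2) ∧
      ∀ S, dualNorm p S ≤ V S + bigOmega p ω ^ 2 / 2 := by
  choose x hx hmax using hω.exists_strong_max hp
  refine ⟨x, fun S => inner ℝ S (x S) - ω (x S), ?_, hx, ?_, ?_, ?_⟩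
  · obtain ⟨c, hc, hcp⟩ := exists_mul_norm_le_seminorm hp
    rw [continuous_iff_continuousAt]
    intro S
    -- Adding the strong maximality inequalities at `S` and `T` gives `p (x T - x S) ^ 2 ≤ ⟨T - S, x
    -- T - x S⟩`, so `x` is 1-Lipschitz from the conjugate norm to `p`.
    have hle : ∀ T, ‖x T - x S‖ ≤ c⁻¹ * dualNorm p (T - S) := by
      intro T
      have h1 := hmax S (x T) (hx T)
      have h2 := hmax T (x S) (hx S)
      have h3 := inner_le_mul_dualNorm hp (x T - x S) (T - S)
      rw [map_sub_rev] at h2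
      rw [real_inner_comm, inner_sub_left, inner_sub_right, inner_sub_right] at h3
      have h4 : p (x T - x S) * p (x T - x S) ≤ p (x T - x S) * dualNorm p (T - S) := by
        nlinarith
      have h5 : p (x T - x S) ≤ dualNorm p (T - S) := by
        rcases (apply_nonneg p (x T - x S)).eq_or_lt with h | h
        · rw [← h]; exact dualNorm_nonneg hp _
        · exact le_of_mul_le_mul_left h4 h
      rw [inv_mul_eq_div, le_div_iff₀ hc, mul_comm]
      exact (hcp _).trans h5
    rw [ContinuousAt, tendsto_iff_norm_sub_tendsto_zero]
    refine squeeze_zero (fun _ => norm_nonneg _) hle ?_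
    have hcont : Continuous fun T => c⁻¹ * dualNorm p (T - S) :=
      ((continuous_dualNorm hp).comp (continuous_id.sub continuous_const)).const_mul _
    have h0 : dualNorm p (0 : E) = 0 := by simpa using dualNorm_smul hp le_rfl (0 : E)
    simpa [h0] using hcont.tendsto S
  · have := hω.half_sq_le (hx 0)
    have h2 := sq_nonneg (p (x 0))
    simp only [inner_zero_left]
    linarith
  · intro S D
    have h1 := hmax S (x (S + D)) (hx _)
    have h2 := inner_le_mul_dualNorm hp (x (S + D) - x S) D
    -- Young's inequality absorbs the displacement of the maximiser into the quadratic gain.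
    have h3 := sq_nonneg (p (x (S + D) - x S) - dualNorm p D)
    rw [real_inner_comm, inner_sub_right] at h2
    simp only [inner_add_left]
    nlinarith
  · intro S
    refine dualNorm_le_of_forall fun y hy => ?_
    have h1 := hmax S y hy
    have h2 := hω.le_half_bigOmega_sq hp hy
    have h3 := sq_nonneg (p (y - x S))
    rw [real_inner_comm]
    linarith

omit [FiniteDimensional ℝ E] hp in
theorem potential_le_pathSum {Ξ : Type*} {x : E → E} {V : E → ℝ}
    (hV : ∀ S D, V (S + D) ≤ V S + inner ℝ D (x S) + dualNorm p D ^ 2 / 2)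
    (D : Ξ → E) (n : ℕ) (S : E) (ξ : Fin n → Ξ) :
    V (S + ∑ t, D (ξ t)) ≤ V S
      + pathSum (fun S z => inner ℝ (D z) (x S)) (fun S z => S + D z) n S ξ
      + (∑ t, dualNorm p (D (ξ t)) ^ 2) / 2 := by
  induction n generalizing S with
  | zero => simp [pathSum]
  | succ n ih =>
    have h1 := ih (S + D (ξ 0)) (Fin.tail ξ)
    have h2 := hV S (D (ξ 0))
    rw [Fin.sum_univ_succ, Fin.sum_univ_succ, pathSum, ← add_assoc]
    simp only [Fin.tail] at h1 ⊢
    linarith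

/-- Large deviations of the conjugate norm of a sum of independent centred random vectors. -/
theorem IsDistGen.measure_dualNorm_sum_gt_le [MeasurableSpace E] [BorelSpace E]
    (hω : IsDistGen p ω) {Ξ : Type*} [MeasurableSpace Ξ] (P : Measure Ξ) [IsProbabilityMeasure P]
    {D : Ξ → E} (hD : Measurable D) (hDi : Integrable D P) (hD0 : ∫ z, D z ∂P = 0)
    {M : ℝ} (hM : 0 < M)
    (hexp : ∫⁻ z, ENNReal.ofReal (Real.exp (dualNorm p (D z) ^ 2 / M ^ 2)) ∂P
      ≤ ENNReal.ofReal (Real.exp 1))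
    {n : ℕ} (hn : 1 ≤ n) (s : ℝ) {lam : ℝ}
    (hlam : lam ∈ Icc 0 (2 * Real.sqrt (tauStar * n))) :
    (Measure.pi fun _ : Fin n => P)
      {ξ | M * Real.sqrt n * (bigOmega p ω / 2 * (1 + s ^ 2) + lam) < dualNorm p (∑ t, D (ξ t))}
      ≤ ENNReal.ofReal (Real.exp (-(n * (s ^ 2 - 1))))
        + ENNReal.ofReal (Real.exp (-(lam ^ 2 / (4 * tauStar)))) := by
  have hn0 : (0 : ℝ) < n := by exact_mod_cast hn
  have hs0 : 0 < Real.sqrt n := Real.sqrt_pos.2 hn0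
  have hs2 : Real.sqrt n ^ 2 = n := Real.sq_sqrt hn0.le
  have hdn : Measurable fun z => dualNorm p (D z) := (continuous_dualNorm hp).measurable.comp hD
  rcases subsingleton_or_nontrivial E with hE | hE
  -- On the zero space `Ω` may vanish, which would make the step size zero, but the event is empty.
  · have h0 : ∀ y : E, dualNorm p y = 0 := fun y => by
      rw [Subsingleton.elim y 0]; simpa using dualNorm_smul hp le_rfl (0 : E)
    have hempty : {ξ : Fin n → Ξ | M * Real.sqrt n * (bigOmega p ω / 2 * (1 + s ^ 2) + lam)
        < dualNorm p (∑ t, D (ξ t))} = ∅ := by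
      refine eq_empty_of_forall_notMem fun ξ hξ => ?_
      have := bigOmega_nonneg (p := p) (ω := ω)
      have h1 : 0 ≤ M * Real.sqrt n * (bigOmega p ω / 2 * (1 + s ^ 2) + lam) := by
        have := hlam.1
        positivity
      rw [mem_ofPred_eq, h0] at hξ
      linarith
    rw [hempty]
    simp
  have hΩ := hω.bigOmega_pos hp
  obtain ⟨x, V, hxc, hxB, hV0, hV, hVd⟩ := hω.exists_dual_averaging hp
  -- This step balances `Ω² / (2γ)` against `γ n M² / 2`, the size of the quadratic term when the
  -- squared conjugate norms sum to `n M²`.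
  set γ := bigOmega p ω / (M * Real.sqrt n) with hγ
  have hγ0 : 0 < γ := by positivity
  set h : E → Ξ → ℝ := fun S z => inner ℝ (D z) (x S) with hh
  set u : E → Ξ → E := fun S z => S + γ • D z with hu
  have hhm : Measurable (Function.uncurry h) := by
    have : Measurable fun z : E × Ξ => inner ℝ (D z.2) (x z.1) :=
      (hD.comp measurable_snd).inner (hxc.measurable.comp measurable_fst)
    exact this
  have hum : Measurable (Function.uncurry u) := by
    have : Measurable fun z : E × Ξ => z.1 + γ • D z.2 := by fun_prop
    exact this
  have hdet : ∀ ξ : Fin n → Ξ, dualNorm p (∑ t, D (ξ t)) ≤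
      bigOmega p ω / 2 * M * Real.sqrt n + pathSum h u n 0 ξ
        + bigOmega p ω / (2 * M * Real.sqrt n) * ∑ t, dualNorm p (D (ξ t)) ^ 2 := by
    intro ξ
    have h1 := potential_le_pathSum hV (fun z => γ • D z) n 0 ξ
    have h2 := hVd (∑ t, γ • D (ξ t))
    have h3 : pathSum (fun S z => inner ℝ (γ • D z) (x S)) u n 0 ξ = γ * pathSum h u n 0 ξ := by
      rw [← pathSum_const_mul]
      simp only [hh, real_inner_smul_left]
    rw [zero_add, h3] at h1
    simp only [dualNorm_smul hp hγ0.le, mul_pow, ← Finset.mul_sum] at h1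
    rw [← Finset.smul_sum, dualNorm_smul hp hγ0.le] at h2
    rw [← Finset.smul_sum] at h1
    have h4 : γ * dualNorm p (∑ t, D (ξ t)) ≤ γ * (bigOmega p ω / 2 * M * Real.sqrt n
        + pathSum h u n 0 ξ
        + bigOmega p ω / (2 * M * Real.sqrt n) * ∑ t, dualNorm p (D (ξ t)) ^ 2) := by
      have e1 : γ * (bigOmega p ω / 2 * M * Real.sqrt n) = bigOmega p ω ^ 2 / 2 := by
        rw [hγ]; field_simp
      have e2 : γ * (bigOmega p ω / (2 * M * Real.sqrt n)) = γ ^ 2 / 2 := by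
        rw [hγ]; field_simp
      rw [mul_add, mul_add, e1, ← mul_assoc, e2]
      linarith
    exact le_of_mul_le_mul_left h4 hγ0
  have hsub : {ξ : Fin n → Ξ | M * Real.sqrt n * (bigOmega p ω / 2 * (1 + s ^ 2) + lam)
        < dualNorm p (∑ t, D (ξ t))} ⊆
      {ξ | n * s ^ 2 * M ^ 2 ≤ pathSum (fun _ z => dualNorm p (D z) ^ 2) u n 0 ξ} ∪
      {ξ | lam * M * Real.sqrt n ≤ pathSum h u n 0 ξ} := by
    intro ξ hξ
    by_contra hcon
    simp only [mem_union, mem_ofPred_eq, not_or, not_le] at hcon hξ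
    rw [pathSum_of_forall_eq (fun z => dualNorm p (D z) ^ 2)] at hcon
    have h1 := hdet ξ
    have h2 : bigOmega p ω / (2 * M * Real.sqrt n) * ∑ t, dualNorm p (D (ξ t)) ^ 2
        ≤ bigOmega p ω / (2 * M * Real.sqrt n) * (n * s ^ 2 * M ^ 2) := by
      gcongr
      exact hcon.1.le
    have h3 : bigOmega p ω / (2 * M * Real.sqrt n) * (n * s ^ 2 * M ^ 2)
        = bigOmega p ω / 2 * s ^ 2 * M * Real.sqrt n := by
      nth_rewrite 2 [← hs2]
      field_simp
    nlinarith [hcon.2]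
  refine (measure_mono hsub).trans ((measure_union_le _ _).trans (add_le_add ?_ ?_))
  · have hsqm : Measurable (Function.uncurry fun (_ : E) z => dualNorm p (D z) ^ 2) := by
      have : Measurable fun z : E × Ξ => dualNorm p (D z.2) ^ 2 :=
        (hdn.comp measurable_snd).pow_const 2
      exact this
    -- With this `θ` the moment hypothesis is the one-step bound itself, and the exponent is `n - n
    -- s²`.
    have := measure_pathSum_ge_le P hsqm hum (θ := (M ^ 2)⁻¹) (K := 1) (c := n * s ^ 2 * M ^ 2)
      (by positivity) (fun _ => by simpa only [inv_mul_eq_div] using hexp) n 0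
    refine this.trans (le_of_eq ?_)
    congr 2
    field_simp
    ring
  · refine measure_pathSum_ge_le_of_sq P hhm hum (fun S => ?_) (fun S => ?_) hM (fun S => ?_)
      hn hlam 0
    · exact hDi.inner_const (𝕜 := ℝ) (x S)
    · have h1 := integral_inner (𝕜 := ℝ) hDi (x S)
      rw [hD0, inner_zero_right] at h1
      simp only [hh]
      rw [← h1]
      exact integral_congr_ae (Filter.Eventually.of_forall fun z => real_inner_comm _ _)
    · refine le_trans (lintegral_mono fun z => ENNReal.ofReal_le_ofReal (Real.exp_le_exp.2 ?_)) hexp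
      have := sq_inner_le_sq_dualNorm hp (hxB S) (D z)
      gcongr

end DualAveraging

/-! ### Measurable selection of subgradients. -/

section Selection

theorem convexOn_univ_apply_le {E : Type*} [AddCommGroup E] [Module ℝ E] {f : E → ℝ}
    (hf : ConvexOn ℝ univ f) (x y : E) {r t : ℝ} (hr : 0 ≤ r) (ht : 0 ≤ t) (hrt : r + t = 1) :
    f (r • x + t • y) ≤ r * f x + t * f y :=
  hf.2 (mem_univ x) (mem_univ y) hr ht hrt

/-- The slopes of a convex function are monotone, so the infimum is the right derivative at `0`, a
subgradient there. Taking it over countably many slopes preserves measurability in a parameter. -/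
theorem mul_iInf_slope_le {f : ℝ → ℝ} (hf : ConvexOn ℝ univ f) (h0 : f 0 = 0) (t : ℝ) :
    t * (⨅ k : ℕ, ((k : ℝ) + 1) * f ((k : ℝ) + 1)⁻¹) ≤ f t := by
  have hneg : ∀ r > 0, ∀ k : ℕ, -(f (-r) / r) ≤ ((k : ℝ) + 1) * f ((k : ℝ) + 1)⁻¹ := by
    intro r hr k
    set a : ℝ := ((k : ℝ) + 1)⁻¹ with ha
    have ha0 : 0 < a := by positivity
    have h1 := convexOn_univ_apply_le hf a (-r) (r := r / (a + r)) (t := a / (a + r))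
      (by positivity) (by positivity) (by field_simp; ring)
    have h2 : (r / (a + r)) • a + (a / (a + r)) • (-r) = 0 := by
      simp only [smul_eq_mul]; field_simp; ring
    rw [h2, h0, div_mul_eq_mul_div, div_mul_eq_mul_div, ← add_div] at h1
    have h3 : 0 ≤ r * f a + a * f (-r) := by
      have h4 := mul_le_mul_of_nonneg_right h1 (add_pos ha0 hr).le
      rwa [zero_mul, div_mul_cancel₀ _ (add_pos ha0 hr).ne'] at h4
    have hk : (k : ℝ) + 1 = a⁻¹ := by rw [ha, inv_inv]
    rw [hk, inv_mul_eq_div, ← neg_div, div_le_div_iff₀ hr ha0]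
    linarith
  have hbdd : BddBelow (range fun k : ℕ => ((k : ℝ) + 1) * f ((k : ℝ) + 1)⁻¹) :=
    ⟨_, forall_mem_range.2 fun k => hneg 1 one_pos k⟩
  rcases lt_trichotomy t 0 with ht | rfl | ht
  · have h1 := le_ciInf (hneg (-t) (neg_pos.2 ht))
    rw [neg_neg, div_neg, neg_neg] at h1
    have h2 := mul_le_mul_of_nonpos_left h1 ht.le
    rwa [mul_div_cancel₀ _ ht.ne] at h2
  · simp [h0]
  · obtain ⟨k, hk⟩ := exists_nat_one_div_lt ht
    rw [one_div] at hk
    set a : ℝ := ((k : ℝ) + 1)⁻¹ with ha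
    have ha0 : 0 < a := by positivity
    have h1 := convexOn_univ_apply_le hf t 0 (r := a / t) (t := 1 - a / t) (by positivity)
      (sub_nonneg.2 ((div_le_one ht).2 hk.le)) (by ring)
    simp only [smul_eq_mul, mul_zero, add_zero, h0, div_mul_cancel₀ _ ht.ne'] at h1
    have h2 : ⨅ k : ℕ, ((k : ℝ) + 1) * f ((k : ℝ) + 1)⁻¹ ≤ a⁻¹ * f a :=
      (ciInf_le hbdd k).trans_eq (by simp only [ha, inv_inv])
    have h3 := mul_le_mul_of_nonneg_left h1 (by positivity : 0 ≤ a⁻¹)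
    have h4 : a⁻¹ * (a / t * f t) = f t / t := by field_simp
    rw [h4] at h3
    have h5 := mul_le_mul_of_nonneg_left (h2.trans h3) ht.le
    rwa [mul_div_cancel₀ _ ht.ne'] at h5

variable {E : Type*} [NormedAddCommGroup E] [InnerProductSpace ℝ E] [FiniteDimensional ℝ E]
  {Ξ : Type*} [MeasurableSpace Ξ]

/-- A measurable family of convex functions vanishing at the origin has a minorant of the same
kind that is bounded by a measurable family of linear functions on a prescribed line. -/
theorem exists_convex_minorant_linear_on_line {φ : Ξ → E → ℝ}
    (hc : ∀ ξ, ConvexOn ℝ univ (φ ξ)) (h0 : ∀ ξ, φ ξ 0 = 0)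
    (hm : ∀ d, Measurable fun ξ => φ ξ d) (e : E) :
    ∃ (ψ : Ξ → E → ℝ) (g : Ξ → ℝ), (∀ ξ, ConvexOn ℝ univ (ψ ξ)) ∧ (∀ ξ, ψ ξ 0 = 0) ∧
      (∀ d, Measurable fun ξ => ψ ξ d) ∧ (∀ ξ d, ψ ξ d ≤ φ ξ d) ∧ Measurable g ∧
      ∀ ξ t, ψ ξ (t • e) ≤ t * g ξ := by
  set g : Ξ → ℝ := fun ξ => ⨅ k : ℕ, ((k : ℝ) + 1) * φ ξ (((k : ℝ) + 1)⁻¹ • e) with hg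
  have hgm : Measurable g := Measurable.iInf fun k => (hm _).const_mul _
  have hgle : ∀ ξ t, t * g ξ ≤ φ ξ (t • e) := fun ξ t =>
    mul_iInf_slope_le (f := fun t => φ ξ (t • e))
      ((hc ξ).comp_linearMap (LinearMap.toSpanSingleton ℝ E e)) (by simp [h0]) t
  -- The midpoint of `t • e + d` and `-d` lies on the line, where `g` already minorises `φ`. Hence
  -- the infimum over `t` defining the minorant is finite, as in the one-dimensional step of
  -- Hahn–Banach.
  have hlow : ∀ ξ d t, -φ ξ (-d) ≤ φ ξ (t • e + d) - t * g ξ := by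
    intro ξ d t
    have h1 := convexOn_univ_apply_le (hc ξ) (t • e + d) (-d) (r := 1 / 2) (t := 1 / 2)
      (by norm_num) (by norm_num) (by norm_num)
    have h2 : (1 / 2 : ℝ) • (t • e + d) + (1 / 2 : ℝ) • (-d) = (t / 2) • e := by
      rw [smul_add, smul_neg, add_neg_cancel_right, smul_smul]; congr 1; ring
    rw [h2] at h1
    have := hgle ξ (t / 2)
    linarith
  have hbdd : ∀ ξ d, BddBelow (range fun t : ℝ => φ ξ (t • e + d) - t * g ξ) := fun ξ d =>
    ⟨_, forall_mem_range.2 (hlow ξ d)⟩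
  refine ⟨fun ξ d => ⨅ t : ℝ, φ ξ (t • e + d) - t * g ξ, g, fun ξ => ⟨convex_univ, ?_⟩, fun ξ => ?_,
    fun d => ?_, fun ξ d => ?_, hgm, fun ξ t => ?_⟩
  · intro x _ y _ a b ha hb hab
    simp only [smul_eq_mul]
    rw [Real.mul_iInf_of_nonneg ha, Real.mul_iInf_of_nonneg hb]
    refine le_ciInf_add_ciInf fun t r => ?_
    refine (ciInf_le (hbdd ξ _) (a * t + b * r)).trans ?_
    have h1 := (hc ξ).2 (mem_univ (t • e + x)) (mem_univ (r • e + y)) ha hb hab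
    have h2 : a • (t • e + x) + b • (r • e + y) = (a * t + b * r) • e + (a • x + b • y) := by
      module
    rw [h2, smul_eq_mul, smul_eq_mul] at h1
    linarith
  · refine le_antisymm ?_ (le_ciInf fun t => ?_)
    · simpa [h0] using ciInf_le (hbdd ξ 0) 0
    · rw [add_zero]; exact sub_nonneg.2 (hgle ξ t)
  · refine measurable_of_Iio fun c => ?_
    -- By continuity in `t`, rational parameters suffice.
    have hset : (fun ξ => ⨅ t : ℝ, φ ξ (t • e + d) - t * g ξ) ⁻¹' Iio c
        = ⋃ q : ℚ, {ξ | φ ξ ((q : ℝ) • e + d) - (q : ℝ) * g ξ < c} := by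
      ext ξ
      simp only [mem_preimage, mem_Iio, mem_iUnion, mem_ofPred_eq, ciInf_lt_iff (hbdd ξ d)]
      constructor
      · intro hex
        have hcont := continuous_of_convexOn_univ (hc ξ)
        have hopen : IsOpen {t : ℝ | φ ξ (t • e + d) - t * g ξ < c} :=
          isOpen_lt (by fun_prop) continuous_const
        exact Rat.denseRange_cast.exists_mem_open hopen hex
      · rintro ⟨q, hq⟩
        exact ⟨q, hq⟩
    rw [hset]
    exact MeasurableSet.iUnion fun q =>
      measurableSet_lt ((hm _).sub (hgm.const_mul _)) measurable_const
  · simpa using ciInf_le (hbdd ξ d) 0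
  -- The parameter `-t` moves the point back to the origin.
  · refine (ciInf_le (hbdd ξ (t • e)) (-t)).trans ?_
    simp [h0]

/-- The lines can be treated one after another because a further minorant keeps the upper bounds
already obtained. -/
theorem exists_convex_minorant_linear_on_lines {ι : Type*} (b : ι → E) {φ : Ξ → E → ℝ}
    (hc : ∀ ξ, ConvexOn ℝ univ (φ ξ)) (h0 : ∀ ξ, φ ξ 0 = 0)
    (hm : ∀ d, Measurable fun ξ => φ ξ d) (T : Finset ι) :
    ∃ (ψ : Ξ → E → ℝ) (g : ι → Ξ → ℝ), (∀ ξ, ConvexOn ℝ univ (ψ ξ)) ∧ (∀ ξ, ψ ξ 0 = 0) ∧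
      (∀ d, Measurable fun ξ => ψ ξ d) ∧ (∀ ξ d, ψ ξ d ≤ φ ξ d) ∧ (∀ i, Measurable (g i)) ∧
      ∀ i ∈ T, ∀ ξ t, ψ ξ (t • b i) ≤ t * g i ξ := by
  classical
  induction T using Finset.induction_on with
  | empty => exact ⟨φ, fun _ _ => 0, hc, h0, hm, fun _ _ => le_rfl, fun _ => measurable_const, by simp⟩
  | insert j T hj ih =>
    obtain ⟨ψ, g, hψc, hψ0, hψm, hψle, hgm, hgle⟩ := ih
    obtain ⟨χ, k, hχc, hχ0, hχm, hχle, hkm, hkle⟩ :=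
      exists_convex_minorant_linear_on_line hψc hψ0 hψm (b j)
    refine ⟨χ, fun i => if i = j then k else g i, hχc, hχ0, hχm,
      fun ξ d => (hχle ξ d).trans (hψle ξ d), fun i => ?_, fun i hi ξ t => ?_⟩
    · dsimp only
      split_ifs
      exacts [hkm, hgm i]
    · dsimp only
      split_ifs with hij
      · subst hij; exact hkle ξ t
      · exact (hχle ξ _).trans (hgle i ((Finset.mem_insert.1 hi).resolve_left hij) ξ t)

/-- A measurable selection of subgradients of a measurable family of convex functions. -/
theorem exists_measurable_subgradient [MeasurableSpace E] [BorelSpace E] {φ : Ξ → E → ℝ}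
    (hc : ∀ ξ, ConvexOn ℝ univ (φ ξ)) (hm : ∀ d, Measurable fun ξ => φ ξ d) (x : E) :
    ∃ G : Ξ → E, Measurable G ∧ ∀ ξ, G ξ ∈ subdiff (φ ξ) x := by
  set b := stdOrthonormalBasis ℝ E with hb
  obtain ⟨ψ, g, hψc, hψ0, -, hψle, hgm, hgle⟩ :=
    exists_convex_minorant_linear_on_lines (b : _ → E) (φ := fun ξ d => φ ξ (x + d) - φ ξ x)
      (fun ξ => by
        have h1 := (hc ξ).translate_right x
        simp only [preimage_univ] at h1
        simp only [sub_eq_add_neg]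
        exact ConvexOn.add h1 (convexOn_const (-φ ξ x) convex_univ))
      (fun ξ => by simp) (fun d => (hm _).sub (hm _)) Finset.univ
  refine ⟨fun ξ => ∑ i, g i ξ • b i,
    Finset.measurable_sum _ fun i _ => (hgm i).smul_const _, fun ξ y => ?_⟩
  set d := y - x with hd
  -- Bounds on the coordinate axes extend to every vector by Jensen's inequality with equal weights,
  -- after scaling each coordinate by the dimension.
  have hneg : ψ ξ (-d) ≤ -inner ℝ (∑ i, g i ξ • b i) d := by
    have hin : -inner ℝ (∑ i, g i ξ • b i) d = ∑ i, -inner ℝ (b i) d * g i ξ := by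
      simp only [sum_inner, real_inner_smul_left, ← Finset.sum_neg_distrib]
      exact Finset.sum_congr rfl fun i _ => by ring
    rw [hin]
    have hrepr : ∑ i, (-inner ℝ (b i) d) • b i = -d := by
      simp only [neg_smul, Finset.sum_neg_distrib]
      rw [b.sum_repr' d]
    rcases isEmpty_or_nonempty (Fin (Module.finrank ℝ E)) with hι | hι
    · rw [← hrepr]; simp [hψ0]
    set n : ℝ := (Fintype.card (Fin (Module.finrank ℝ E)) : ℝ) with hn
    have hn0 : 0 < n := by rw [hn]; exact_mod_cast Fintype.card_pos
    have hj := (hψc ξ).map_sum_le (t := Finset.univ) (w := fun _ => n⁻¹)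
      (p := fun i => (n * -inner ℝ (b i) d) • b i) (fun _ _ => by positivity)
      (by rw [Finset.sum_const, Finset.card_univ, nsmul_eq_mul, ← hn, mul_inv_cancel₀ hn0.ne']) (fun _ _ => mem_univ _)
    simp only [smul_smul, inv_mul_cancel_left₀ hn0.ne', hrepr] at hj
    refine hj.trans (Finset.sum_le_sum fun i _ => ?_)
    have h1 := mul_le_mul_of_nonneg_left (hgle i (Finset.mem_univ i) ξ (n * -inner ℝ (b i) d))
      (by positivity : 0 ≤ n⁻¹)
    rw [mul_assoc, inv_mul_cancel_left₀ hn0.ne'] at h1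
    exact h1
  -- Since `ψ` vanishes at the origin, midpoint convexity turns the upper bound at `-d` into a lower
  -- bound at `d`.
  have hmid := convexOn_univ_apply_le (hψc ξ) d (-d) (r := 1 / 2) (t := 1 / 2)
    (by norm_num) (by norm_num) (by norm_num)
  rw [smul_neg, add_neg_cancel, hψ0] at hmid
  have h1 := hψle ξ d
  simp only [hd, add_sub_cancel] at h1 hmid hneg
  linarith

end Selection

/-! ### Subgradients: optimality, boundedness, integration. -/

section Subdifferential

variable {E : Type*} [NormedAddCommGroup E] [InnerProductSpace ℝ E]

theorem hasFDerivAt_of_mem_subdiff {f : E → ℝ} {x g : E} (hf : DifferentiableAt ℝ f x)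
    (hg : g ∈ subdiff f x) : HasFDerivAt f (innerSL ℝ g) x := by
  have h1 : HasFDerivAt (fun y => f y - innerSL ℝ g y) (fderiv ℝ f x - innerSL ℝ g) x :=
    hf.hasFDerivAt.sub (innerSL ℝ g).hasFDerivAt
  have hmin : IsLocalMin (fun y => f y - innerSL ℝ g y) x := by
    refine Filter.Eventually.of_forall fun y => ?_
    have := hg y
    simp only [innerSL_apply_apply]
    rw [inner_sub_right] at this
    linarith
  have h2 := hmin.hasFDerivAt_eq_zero h1
  rw [← sub_eq_zero.1 h2]
  exact hf.hasFDerivAt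

/-- Differentiability makes `g` the gradient; at a constrained minimum an arbitrary subgradient need
not satisfy this inequality. -/
theorem inner_nonneg_of_isMinOn {f : E → ℝ} {X : Set E} (hX : Convex ℝ X) {x g : E} (hx : x ∈ X)
    (hf : DifferentiableAt ℝ f x) (hg : g ∈ subdiff f x) (hmin : IsMinOn f X x) {y : E}
    (hy : y ∈ X) : 0 ≤ inner ℝ g (y - x) := by
  have := hmin.localize.hasFDerivWithinAt_nonneg
    (hasFDerivAt_of_mem_subdiff hf hg).hasFDerivWithinAt
    (sub_mem_posTangentConeAt_of_segment_subset (hX.segment_subset hx hy))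
  simpa using this

theorem sum_smul_mem_subdiff {ι : Type*} (T : Finset ι) {w : ι → ℝ} (hw : ∀ i, 0 ≤ w i)
    {f : ι → E → ℝ} {g : ι → E} {x : E} (hg : ∀ i, g i ∈ subdiff (f i) x) :
    ∑ i ∈ T, w i • g i ∈ subdiff (fun y => ∑ i ∈ T, w i * f i y) x := by
  intro y
  rw [sum_inner, ← Finset.sum_add_distrib]
  refine Finset.sum_le_sum fun i _ => ?_
  rw [real_inner_smul_left, ← mul_add]
  exact mul_le_mul_of_nonneg_left (hg i y) (hw i)

theorem exists_dualNorm_le_of_mem_subdiff [FiniteDimensional ℝ E] {p : Seminorm ℝ E}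
    (hp : ∀ x, p x = 0 → x = 0) {f : E → ℝ} (hf : ConvexOn ℝ univ f) (x : E) :
    ∃ C, 0 ≤ C ∧ ∀ g ∈ subdiff f x, dualNorm p g ≤ C ∧ dualNorm p (-g) ≤ C := by
  have hfc := continuous_of_convexOn_univ hf
  obtain ⟨C, hC⟩ := ((isCompact_unitBall hp).image
    (by fun_prop : Continuous fun d => f (x + d) - f x)).bddAbove
  have hC' : ∀ d, p d ≤ 1 → f (x + d) - f x ≤ C := fun d hd => hC (mem_image_of_mem _ hd)
  refine ⟨C, by simpa using hC' 0 (by simp), fun g hg => ⟨?_, ?_⟩⟩ <;>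
    refine dualNorm_le_of_forall fun d hd => ?_
  · have h1 := hg (x + d)
    have h2 := hC' d hd
    rw [add_sub_cancel_left, real_inner_comm] at h1
    linarith
  · have h1 := hg (x + -d)
    have h2 := hC' (-d) (by simpa using hd)
    rw [add_sub_cancel_left, inner_neg_right, real_inner_comm] at h1
    rw [inner_neg_right]
    linarith

variable {Ξ : Type*} [MeasurableSpace Ξ] {m : ℕ}

theorem convexOn_expect {P : Measure Ξ} {F : Fin m → E → Ξ → ℝ}
    (hFconv : ∀ i ξ, ConvexOn ℝ univ (fun x => F i x ξ)) (hFint : ∀ i x, Integrable (F i x) P)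
    (i : Fin m) : ConvexOn ℝ univ (expect P F i) := by
  refine ⟨convex_univ, fun x _ y _ a b ha hb hab => ?_⟩
  simp only [expect, smul_eq_mul]
  rw [← integral_const_mul, ← integral_const_mul,
    ← integral_add ((hFint i x).const_mul a) ((hFint i y).const_mul b)]
  exact integral_mono (hFint i _) (((hFint i x).const_mul a).add ((hFint i y).const_mul b))
    fun ξ => (hFconv i ξ).2 (mem_univ x) (mem_univ y) ha hb hab

/-- The point is that the supremum runs over a bounded set, as otherwise `sSup` would be `0`.
Subgradients at `x` are bounded by the increase of the function over `x` plus the unit ball. -/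
theorem dualNorm_sub_le_subgradDev [FiniteDimensional ℝ E] {p : Seminorm ℝ E}
    (hp : ∀ x, p x = 0 → x = 0) {P : Measure Ξ} {F : Fin m → E → Ξ → ℝ}
    (hFconv : ∀ i ξ, ConvexOn ℝ univ (fun x => F i x ξ)) (hFint : ∀ i x, Integrable (F i x) P)
    {x : E} {ξ : Ξ} {i : Fin m} {g h : E} (hg : g ∈ subdiff (fun y => F i y ξ) x)
    (hh : h ∈ subdiff (expect P F i) x) : dualNorm p (g - h) ≤ subgradDev p P F x ξ := by
  choose C hC0 hC using fun i => exists_dualNorm_le_of_mem_subdiff hp (hFconv i ξ) x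
  choose D hD0 hD using fun i => exists_dualNorm_le_of_mem_subdiff hp
    (convexOn_expect hFconv hFint i) x
  refine le_csSup ⟨∑ i, (C i + D i), ?_⟩ ⟨i, g, hg, h, hh, rfl⟩
  rintro r ⟨j, g', hg', h', hh', rfl⟩
  rw [sub_eq_add_neg]
  refine (dualNorm_add_le hp _ _).trans ((add_le_add (hC j g' hg').1 (hD j h' hh').2).trans ?_)
  exact Finset.single_le_sum (f := fun i => C i + D i)
    (fun i _ => add_nonneg (hC0 i) (hD0 i)) (Finset.mem_univ j)

theorem integrable_of_mem_subdiff [FiniteDimensional ℝ E] [MeasurableSpace E] [BorelSpace E]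
    {P : Measure Ξ} {φ : Ξ → E → ℝ} (hφ : ∀ y, Integrable (fun ξ => φ ξ y) P) {x : E} {G : Ξ → E}
    (hG : Measurable G) (hmem : ∀ ξ, G ξ ∈ subdiff (φ ξ) x) : Integrable G P := by
  set b := stdOrthonormalBasis ℝ E with hb
  have hcoord : ∀ d, Integrable (fun ξ => inner ℝ d (G ξ)) P := by
    intro d
    -- The pairing with `d` lies between the negated increment of `φ` along `-d` and its increment
    -- along `d`, both integrable.
    refine Integrable.mono'
      (g := fun ξ => |φ ξ (x + d) - φ ξ x| + |φ ξ (x + -d) - φ ξ x|)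
      (((hφ _).sub (hφ _)).abs.add ((hφ _).sub (hφ _)).abs)
      (measurable_const.inner hG).aestronglyMeasurable (Filter.Eventually.of_forall fun ξ => ?_)
    have h1 := hmem ξ (x + d)
    have h2 := hmem ξ (x + -d)
    rw [add_sub_cancel_left, real_inner_comm] at h1 h2
    rw [inner_neg_left] at h2
    rw [Real.norm_eq_abs, abs_le]
    have h3 := le_abs_self (φ ξ (x + d) - φ ξ x)
    have h4 := le_abs_self (φ ξ (x + -d) - φ ξ x)
    have h5 := abs_nonneg (φ ξ (x + d) - φ ξ x)
    have h6 := abs_nonneg (φ ξ (x + -d) - φ ξ x)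
    constructor <;> linarith
  have hsum : G = fun ξ => ∑ i, inner ℝ (b i) (G ξ) • b i := funext fun ξ => (b.sum_repr' _).symm
  rw [hsum]
  exact integrable_finsetSum _ fun i _ => (hcoord (b i)).smul_const _

theorem integral_mem_subdiff_expect [FiniteDimensional ℝ E] {P : Measure Ξ}
    [IsProbabilityMeasure P] {F : Fin m → E → Ξ → ℝ} (hFint : ∀ i x, Integrable (F i x) P)
    {i : Fin m} {x : E} {G : Ξ → E} (hG : Integrable G P)
    (hmem : ∀ ξ, G ξ ∈ subdiff (fun y => F i y ξ) x) :
    ∫ ξ, G ξ ∂P ∈ subdiff (expect P F i) x := by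
  intro y
  have h1 : Integrable (fun ξ => inner ℝ (y - x) (G ξ)) P := hG.const_inner (𝕜 := ℝ) (y - x)
  rw [real_inner_comm, ← integral_inner (𝕜 := ℝ) hG, expect, expect,
    ← integral_add (hFint i x) h1]
  refine integral_mono ((hFint i x).add h1) (hFint i y) fun ξ => ?_
  have := hmem ξ y
  rwa [real_inner_comm] at this

end Subdifferential

/-! ### A finite minimax theorem by separation. -/

section Minimax

/-- A minimax theorem for finitely many convex functions. -/
theorem exists_weights_of_forall_exists_le {E : Type*} [AddCommGroup E] [Module ℝ E] {m : ℕ}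
    {X : Set E} (hXne : X.Nonempty) {f : Fin m → E → ℝ} (hf : ∀ i, ConvexOn ℝ X (f i)) {c : ℝ}
    (hc : ∀ x ∈ X, ∃ i, c ≤ f i x) :
    ∃ w : Fin m → ℝ, (∀ i, 0 ≤ w i) ∧ ∑ i, w i = 1 ∧ ∀ x ∈ X, c ≤ ∑ i, w i * f i x := by
  obtain ⟨x₀, hx₀⟩ := hXne
  set A : Set (Fin m → ℝ) := {v | ∀ i, v i < 0} with hA
  set T : Set (Fin m → ℝ) := {v | ∃ x ∈ X, ∀ i, f i x - c ≤ v i} with hT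
  have hAc : Convex ℝ A := by
    have : A = ⋂ i, {v : Fin m → ℝ | v i < 0} := by ext; simp [hA]
    rw [this]
    exact convex_iInter fun i => convex_halfSpace_lt (LinearMap.proj i).isLinear 0
  have hAo : IsOpen A := by
    have : A = ⋂ i, {v : Fin m → ℝ | v i < 0} := by ext; simp [hA]
    rw [this]
    exact isOpen_iInter_of_finite fun i => isOpen_lt (continuous_apply i) continuous_const
  have hTc : Convex ℝ T := by
    rintro v ⟨x, hx, hv⟩ u ⟨y, hy, hu⟩ a b ha hb hab
    -- Convexity of `X` is part of the convexity of any `f i`; `hc` provides an index.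
    refine ⟨a • x + b • y, (hf (hc x hx).choose).1 hx hy ha hb hab, fun i => ?_⟩
    have h1 := (hf i).2 hx hy ha hb hab
    have h2 := mul_le_mul_of_nonneg_left (hv i) ha
    have h3 := mul_le_mul_of_nonneg_left (hu i) hb
    simp only [smul_eq_mul, Pi.add_apply, Pi.smul_apply] at h1 ⊢
    have h4 : c = a * c + b * c := by rw [← add_mul, hab, one_mul]
    linarith
  have hdisj : Disjoint A T := by
    rw [Set.disjoint_left]
    rintro v hv ⟨x, hx, hle⟩
    obtain ⟨i, hi⟩ := hc x hx
    have h1 := hle i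
    have h2 := hv i
    linarith
  obtain ⟨φ, u, hφA, hφT⟩ := geometric_hahn_banach_open hAc hAo hTc hdisj
  set l : Fin m → ℝ := fun i => φ (Pi.single i 1) with hl
  have hφ : ∀ v, φ v = ∑ i, l i * v i := by
    intro v
    have := LinearMap.pi_apply_eq_sum_univ φ.toLinearMap v
    simp only [smul_eq_mul] at this
    rw [← ContinuousLinearMap.coe_coe, this]
    refine Finset.sum_congr rfl fun i _ => ?_
    rw [mul_comm, hl]
    simp only [ContinuousLinearMap.coe_coe]
    congr 2
    ext j
    simp [Pi.single_apply, eq_comm]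
  have hmem : ∀ x ∈ X, (fun i => f i x - c) ∈ T := fun x hx => ⟨x, hx, fun i => le_rfl⟩
  have hl0 : ∀ i, 0 ≤ l i := by
    intro i
    by_contra hneg
    rw [not_le] at hneg
    set v : Fin m → ℝ := fun i => f i x₀ - c with hv
    -- `T` is upward closed, and moving by this `r` along a coordinate with `l i < 0` would lower
    -- `φ` to `u - 1`.
    set r := (φ v - u + 1) / (-l i) with hr
    have h0 := hφT v (hmem x₀ hx₀)
    have hr0 : 0 ≤ r := div_nonneg (by linarith) (by linarith)
    have h1 := hφT (v + r • Pi.single i 1) ⟨x₀, hx₀, fun j => by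
      have : 0 ≤ (Pi.single i 1 : Fin m → ℝ) j := by
        rw [Pi.single_apply]; split_ifs <;> norm_num
      have := mul_nonneg hr0 this
      simp only [Pi.add_apply, Pi.smul_apply, smul_eq_mul, hv]
      linarith⟩
    rw [map_add, map_smul, smul_eq_mul] at h1
    change u ≤ φ v + r * l i at h1
    have h2 : r * l i = -(φ v - u + 1) := by
      rw [hr, div_neg, neg_mul, div_mul_cancel₀ _ hneg.ne]
    linarith
  set s := ∑ i, l i with hs
  -- Constant negative vectors lie in `A`; they exclude `s = 0`, and letting `ε` shrink gives `u ≥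
  -- 0`.
  have hconst : ∀ ε > 0, -(ε * s) < u := by
    intro ε hε
    have h1 := hφA (fun _ => -ε) (fun _ => neg_lt_zero.2 hε)
    rw [hφ, ← Finset.sum_mul] at h1
    linarith
  have hs0 : 0 < s := by
    refine (Finset.sum_nonneg fun i _ => hl0 i).lt_of_ne fun h => ?_
    have hz : ∀ i, l i = 0 := fun i =>
      (Finset.sum_eq_zero_iff_of_nonneg fun i _ => hl0 i).1 h.symm i (Finset.mem_univ i)
    have h1 := hconst 1 one_pos
    have h2 := hφT _ (hmem x₀ hx₀)
    rw [hφ] at h2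
    simp only [hz, zero_mul, Finset.sum_const_zero] at h2
    rw [← h.trans hs.symm] at h1
    linarith
  have hu : 0 ≤ u := by
    by_contra hneg
    rw [not_le] at hneg
    have h1 := hconst (-u / s) (div_pos (by linarith) hs0)
    rw [div_mul_cancel₀ _ hs0.ne'] at h1
    linarith
  refine ⟨fun i => l i / s, fun i => div_nonneg (hl0 i) hs0.le, ?_, fun x hx => ?_⟩
  · rw [← Finset.sum_div, div_self hs0.ne']
  · have h1 := hu.trans (hφT _ (hmem x hx))
    rw [hφ] at h1
    simp only [mul_sub, Finset.sum_sub_distrib, ← Finset.sum_mul] at h1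
    have h2 : ∑ i, l i / s * f i x = (∑ i, l i * f i x) / s := by
      rw [Finset.sum_div]
      exact Finset.sum_congr rfl fun i _ => by ring
    rw [h2, le_div_iff₀ hs0]
    linarith

end Minimax

/-! ### Optimal values and the diameter of `X`. -/

section Values

variable {E : Type*} [NormedAddCommGroup E] {m : ℕ} {X : Set E} {φ : Fin m → E → ℝ}

theorem continuous_ciSup_fin [NeZero m] (hφ : ∀ i, Continuous (φ i)) :
    Continuous fun x => ⨆ i, φ i x := by
  have h : (fun x => ⨆ i, φ i x) = fun x => Finset.univ.sup' Finset.univ_nonempty fun i => φ i x :=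
    funext fun x => (Finset.sup'_univ_eq_ciSup _).symm
  rw [h]
  exact Continuous.finset_sup'_apply _ fun i _ => hφ i

theorem minimaxValue_le [NeZero m] (hX : IsCompact X) (hφ : ∀ i, Continuous (φ i)) {x : E}
    (hx : x ∈ X) : minimaxValue X φ ≤ ⨆ i, φ i x :=
  csInf_le (hX.image (continuous_ciSup_fin hφ)).bddBelow (mem_image_of_mem _ hx)

omit [NormedAddCommGroup E] in
theorem le_minimaxValue (hX : X.Nonempty) {c : ℝ} (h : ∀ x ∈ X, c ≤ ⨆ i, φ i x) :
    c ≤ minimaxValue X φ :=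
  le_csInf (hX.image _) (forall_mem_image.2 h)

theorem exists_minimaxValue_eq [NeZero m] (hX : IsCompact X) (hne : X.Nonempty)
    (hφ : ∀ i, Continuous (φ i)) : ∃ x ∈ X, ⨆ i, φ i x = minimaxValue X φ := by
  obtain ⟨x, hx, hmin⟩ := hX.exists_isMinOn hne (continuous_ciSup_fin hφ).continuousOn
  exact ⟨x, hx, (le_minimaxValue hne fun y hy => hmin hy).antisymm (minimaxValue_le hX hφ hx)⟩

theorem sum_mul_le_ciSup {w v : Fin m → ℝ} (hw : ∀ i, 0 ≤ w i) (hw1 : ∑ i, w i = 1) :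
    ∑ i, w i * v i ≤ ⨆ i, v i := by
  calc ∑ i, w i * v i ≤ ∑ i, w i * ⨆ j, v j := Finset.sum_le_sum fun i _ =>
        mul_le_mul_of_nonneg_left (le_ciSup (finite_range v).bddAbove i) (hw i)
    _ = ⨆ j, v j := by rw [← Finset.sum_mul, hw1, one_mul]

variable [InnerProductSpace ℝ E]

theorem seminorm_sub_le_two_mul_circumradius [FiniteDimensional ℝ E] (p : Seminorm ℝ E)
    (hX : IsCompact X) {x y : E} (hx : x ∈ X) (hy : y ∈ X) :
    p (x - y) ≤ 2 * circumradius p X := by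
  have hhalf : p (x - y) / 2 ≤ circumradius p X := by
    refine le_csInf ?_ ?_
    · obtain ⟨C, hC⟩ := (hX.image (continuous_seminorm p)).bddAbove
      have hC' : ∀ z ∈ X, p z ≤ C := fun z hz => hC (mem_image_of_mem _ hz)
      exact ⟨C, (apply_nonneg p x).trans (hC' x hx), 0, fun z hz => by simpa using hC' z hz⟩
    · rintro r ⟨-, c, hc⟩
      have h1 := map_add_le_add p (x - c) (c - y)
      rw [sub_add_sub_cancel, map_sub_rev p c y] at h1
      have h2 := hc x hx
      have h3 := hc y hy
      linarith
  linarith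

theorem continuous_sampleAvg [FiniteDimensional ℝ E] {Ξ : Type*} {N : ℕ} {F : Fin m → E → Ξ → ℝ}
    (hF : ∀ i ξ, ConvexOn ℝ univ (fun x => F i x ξ)) (ξ : Fin N → Ξ) (i : Fin m) :
    Continuous (sampleAvg F ξ i) :=
  (continuous_finsetSum _ fun t _ => continuous_of_convexOn_univ (hF i (ξ t))).const_mul _

end Values

/-! ### Sample laws and scalar deviations. -/

section Sampling

variable {Ξ : Type*} [MeasurableSpace Ξ]

/-- The joint law of the sample is the product measure. An inequality is enough, and it holds for
every set `T`, so the events on optimal values need not be shown measurable. -/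
theorem measure_sample_mem_le {P : Measure Ξ} {N : ℕ} {S : Type*} [MeasurableSpace S]
    {Q : Measure S} {sample : Fin N → S → Ξ} (hlaw : ∀ t, HasLaw (sample t) P Q)
    [IsProbabilityMeasure Q] (hindep : iIndepFun sample Q) (T : Set (Fin N → Ξ)) :
    Q {a | (fun t => sample t a) ∈ T} ≤ (Measure.pi fun _ : Fin N => P) T := by
  have hm : ∀ t, AEMeasurable (sample t) Q := fun t => (hlaw t).aemeasurable
  have hmap : Q.map (fun a t => sample t a) = Measure.pi fun _ : Fin N => P := by
    rw [(iIndepFun_iff_map_fun_eq_pi_map hm).1 hindep]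
    simp only [(hlaw _).map_eq]
  rw [← hmap]
  exact Measure.le_map_apply (aemeasurable_pi_lambda _ hm) T

theorem measure_sum_ge_le (P : Measure Ξ) [IsProbabilityMeasure P] {Y : Ξ → ℝ}
    (hY : Measurable Y) (hi : Integrable Y P) (h0 : ∫ x, Y x ∂P = 0) {M : ℝ} (hM : 0 < M)
    (hexp : ∫⁻ x, ENNReal.ofReal (Real.exp (Y x ^ 2 / M ^ 2)) ∂P ≤ ENNReal.ofReal (Real.exp 1))
    {n : ℕ} (hn : 1 ≤ n) {lam : ℝ} (hlam : lam ∈ Icc 0 (2 * Real.sqrt (tauStar * n))) :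
    (Measure.pi fun _ : Fin n => P) {ξ | lam * M * Real.sqrt n ≤ ∑ t, Y (ξ t)}
      ≤ ENNReal.ofReal (Real.exp (-(lam ^ 2 / (4 * tauStar)))) := by
  have hh : Measurable (Function.uncurry fun (_ : Unit) => Y) := hY.comp measurable_snd
  have hu : Measurable (Function.uncurry fun (S : Unit) (_ : Ξ) => S) := measurable_fst
  have := measure_pathSum_ge_le_of_sq P hh hu (fun _ => hi) (fun _ => h0) hM (fun _ => hexp) hn
    hlam ()
  simpa only [pathSum_of_forall_eq] using this

/-- Jensen's inequality for the square and then for `exp`: a convex combination inherits the moment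
bound with the same `M`. -/
theorem lintegral_exp_sq_sum_le (P : Measure Ξ) {ι : Type*} [Fintype ι]
    {w : ι → ℝ} (hw : ∀ i, 0 ≤ w i) (hw1 : ∑ i, w i = 1) {Y : ι → Ξ → ℝ}
    (hY : ∀ i, Measurable (Y i)) {M : ℝ}
    (hexp : ∀ i, ∫⁻ x, ENNReal.ofReal (Real.exp (Y i x ^ 2 / M ^ 2)) ∂P
      ≤ ENNReal.ofReal (Real.exp 1)) :
    ∫⁻ x, ENNReal.ofReal (Real.exp ((∑ i, w i * Y i x) ^ 2 / M ^ 2)) ∂P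
      ≤ ENNReal.ofReal (Real.exp 1) := by
  have hpt : ∀ x, Real.exp ((∑ i, w i * Y i x) ^ 2 / M ^ 2)
      ≤ ∑ i, w i * Real.exp (Y i x ^ 2 / M ^ 2) := by
    intro x
    have h1 : (∑ i, w i * Y i x) ^ 2 ≤ ∑ i, w i * Y i x ^ 2 := by
      simpa using (even_two.convexOn_pow (𝕜 := ℝ)).map_sum_le (t := Finset.univ) (w := w)
        (p := fun i => Y i x) (fun i _ => hw i) hw1 (fun _ _ => mem_univ _)
    have h2 : Real.exp (∑ i, w i * (Y i x ^ 2 / M ^ 2))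
        ≤ ∑ i, w i * Real.exp (Y i x ^ 2 / M ^ 2) := by
      simpa using convexOn_exp.map_sum_le (t := Finset.univ) (w := w)
        (p := fun i => Y i x ^ 2 / M ^ 2) (fun i _ => hw i) hw1 (fun _ _ => mem_univ _)
    refine le_trans (Real.exp_le_exp.2 ?_) h2
    simp only [← mul_div_assoc, ← Finset.sum_div]
    gcongr
  calc ∫⁻ x, ENNReal.ofReal (Real.exp ((∑ i, w i * Y i x) ^ 2 / M ^ 2)) ∂P
      ≤ ∫⁻ x, ∑ i, ENNReal.ofReal (w i) * ENNReal.ofReal (Real.exp (Y i x ^ 2 / M ^ 2)) ∂P := by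
        refine lintegral_mono fun x => (ENNReal.ofReal_le_ofReal (hpt x)).trans_eq ?_
        rw [ENNReal.ofReal_sum_of_nonneg fun i _ => mul_nonneg (hw i) (Real.exp_pos _).le]
        exact Finset.sum_congr rfl fun i _ => ENNReal.ofReal_mul (hw i)
    _ = ∑ i, ENNReal.ofReal (w i) * ∫⁻ x, ENNReal.ofReal (Real.exp (Y i x ^ 2 / M ^ 2)) ∂P := by
        rw [lintegral_finsetSum _ fun i _ => by have := hY i; fun_prop]
        exact Finset.sum_congr rfl fun i _ =>
          lintegral_const_mul _ (by have := hY i; fun_prop)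
    _ ≤ ∑ i, ENNReal.ofReal (w i) * ENNReal.ofReal (Real.exp 1) := by
        gcongr with i
        exact hexp i
    _ = ENNReal.ofReal (Real.exp 1) := by
        rw [← Finset.sum_mul, ← ENNReal.ofReal_sum_of_nonneg fun i _ => hw i, hw1]
        simp

end Sampling

/-! ### The two deviation bounds under the product measure. -/

section Deviations

variable {E : Type*} [NormedAddCommGroup E] [InnerProductSpace ℝ E] [FiniteDimensional ℝ E]
  {X : Set E}
  {Ξ : Type*} [MeasurableSpace Ξ] {P : Measure Ξ} [IsProbabilityMeasure P]
  {m : ℕ} [NeZero m] {F : Fin m → E → Ξ → ℝ}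

theorem measure_minimaxValue_sampleAvg_gt_le (hXne : X.Nonempty) (hXcomp : IsCompact X)
    (hFmeas : ∀ i x, Measurable (F i x)) (hFconv : ∀ i ξ, ConvexOn ℝ univ (fun x => F i x ξ))
    (hFint : ∀ i x, Integrable (F i x) P) {M : ℝ} (hM : 0 < M)
    (hexp : ∀ i, ∀ x ∈ X, ∫⁻ ξ, ENNReal.ofReal (Real.exp ((F i x ξ - expect P F i x) ^ 2 / M ^ 2)) ∂P
      ≤ ENNReal.ofReal (Real.exp 1))
    {N : ℕ} (hN : 1 ≤ N) {μ : ℝ} (hμ : μ ∈ Icc 0 (2 * Real.sqrt (tauStar * N))) :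
    (Measure.pi fun _ : Fin N => P)
      {ξ | minimaxValue X (sampleAvg F ξ) > minimaxValue X (expect P F) + μ * M / Real.sqrt N}
      ≤ ENNReal.ofReal (m * Real.exp (-(μ ^ 2 / (4 * tauStar)))) := by
  have hN0 : (0 : ℝ) < N := by exact_mod_cast hN
  obtain ⟨x, hx, hopt⟩ := exists_minimaxValue_eq hXcomp hXne
    fun i => continuous_of_convexOn_univ (convexOn_expect (P := P) hFconv hFint i)
  have hsub : {ξ : Fin N → Ξ | minimaxValue X (sampleAvg F ξ)
      > minimaxValue X (expect P F) + μ * M / Real.sqrt N} ⊆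
      ⋃ i, {ξ | μ * M * Real.sqrt N ≤ ∑ t, (F i x (ξ t) - expect P F i x)} := by
    intro ξ hξ
    have h1 : minimaxValue X (expect P F) + μ * M / Real.sqrt N < ⨆ i, sampleAvg F ξ i x :=
      lt_of_lt_of_le hξ (minimaxValue_le hXcomp (continuous_sampleAvg hFconv ξ) hx)
    obtain ⟨i, hi⟩ := exists_lt_of_lt_ciSup h1
    refine mem_iUnion.2 ⟨i, ?_⟩
    have h2 : expect P F i x ≤ minimaxValue X (expect P F) := by
      rw [← hopt]
      exact le_ciSup (f := fun i => expect P F i x) (finite_range _).bddAbove i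
    have h3 : expect P F i x + μ * M / Real.sqrt N < (N : ℝ)⁻¹ * ∑ t, F i x (ξ t) :=
      lt_of_le_of_lt (by linarith) hi
    rw [inv_mul_eq_div, lt_div_iff₀ hN0] at h3
    have h4 : μ * M / Real.sqrt N * N = μ * M * Real.sqrt N := by
      rw [div_mul_eq_mul_div, mul_div_assoc, Real.div_sqrt]
    simp only [mem_ofPred_eq, Finset.sum_sub_distrib, Finset.sum_const, Finset.card_univ,
      Fintype.card_fin, nsmul_eq_mul]
    linarith
  refine (measure_mono hsub).trans ((measure_iUnion_fintype_le _ _).trans ?_)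
  refine (Finset.sum_le_sum fun i _ => measure_sum_ge_le P ((hFmeas i x).sub_const _)
    ((hFint i x).sub (integrable_const _)) ?_ hM (hexp i x hx) hN hμ).trans_eq ?_
  · rw [integral_sub (hFint i x) (integrable_const _)]
    simp [expect]
  · rw [Finset.sum_const, Finset.card_univ, Fintype.card_fin, nsmul_eq_mul,
      ENNReal.ofReal_mul (Nat.cast_nonneg m), ENNReal.ofReal_natCast]

theorem measure_minimaxValue_sampleAvg_lt_le [MeasurableSpace E] [BorelSpace E] {p : Seminorm ℝ E} (hp : ∀ x, p x = 0 → x = 0)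
    {ω : E → ℝ} (hω : IsDistGen p ω) (hXne : X.Nonempty) (hXconv : Convex ℝ X)
    (hXcomp : IsCompact X)
    (hFmeas : ∀ i x, Measurable (F i x)) (hFconv : ∀ i ξ, ConvexOn ℝ univ (fun x => F i x ξ))
    (hFint : ∀ i x, Integrable (F i x) P)
    (hdiff : ∀ i, ∀ x ∈ X, DifferentiableAt ℝ (expect P F i) x)
    {M₁ M₂ : ℝ} (hM₁ : 0 < M₁) (hM₂ : 0 < M₂)
    (hexp₁ : ∀ i, ∀ x ∈ X,
      ∫⁻ ξ, ENNReal.ofReal (Real.exp ((F i x ξ - expect P F i x) ^ 2 / M₁ ^ 2)) ∂P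
        ≤ ENNReal.ofReal (Real.exp 1))
    (hexp₂ : ∀ x ∈ X, ∫⁻ ξ, ENNReal.ofReal (Real.exp (subgradDev p P F x ξ ^ 2 / M₂ ^ 2)) ∂P
      ≤ ENNReal.ofReal (Real.exp 1))
    {N : ℕ} (hN : 1 ≤ N) (s : ℝ) {lam : ℝ}
    (hlam : lam ∈ Icc 0 (2 * Real.sqrt (tauStar * N))) {μ : ℝ}
    (hμ : μ ∈ Icc 0 (2 * Real.sqrt (tauStar * N))) :
    (Measure.pi fun _ : Fin N => P)
      {ξ | minimaxValue X (sampleAvg F ξ) < minimaxValue X (expect P F)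
        - (μ * M₁ + 2 * M₂ * circumradius p X
            * (bigOmega p ω / 2 * (1 + s ^ 2) + lam)) / Real.sqrt N}
      ≤ ENNReal.ofReal (Real.exp (-(μ ^ 2 / (4 * tauStar)))
        + (Real.exp (-(N * (s ^ 2 - 1))) + Real.exp (-(lam ^ 2 / (4 * tauStar))))) := by
  have hN0 : (0 : ℝ) < N := by exact_mod_cast hN
  have hconvE := fun i => convexOn_expect (P := P) hFconv hFint i
  have hcont := fun i => continuous_of_convexOn_univ (hconvE i)
  obtain ⟨w, hw0, hw1, hwle⟩ := exists_weights_of_forall_exists_le hXne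
    (f := expect P F) (c := minimaxValue X (expect P F))
    (fun i => (hconvE i).subset (subset_univ X) hXconv) (fun x hx => by
      obtain ⟨i, hi⟩ := exists_eq_ciSup_of_finite (f := fun i => expect P F i x)
      exact ⟨i, hi ▸ minimaxValue_le hXcomp hcont hx⟩)
  obtain ⟨x, hx, hopt⟩ := exists_minimaxValue_eq hXcomp hXne hcont
  choose G hGm hG using fun i => exists_measurable_subgradient (φ := fun ξ y => F i y ξ)
    (hFconv i) (fun y => hFmeas i y) x
  have hGi := fun i => integrable_of_mem_subdiff (P := P) (hFint i) (hGm i) (hG i)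
  have hh := fun i => integral_mem_subdiff_expect hFint (hGi i) (hG i)
  have hfirst : ∀ y ∈ X, 0 ≤ inner ℝ (∑ i, w i • ∫ ξ, G i ξ ∂P) (y - x) := fun y hy => by
    refine inner_nonneg_of_isMinOn hXconv hx (f := fun y => ∑ i, w i * expect P F i y)
      (DifferentiableAt.fun_sum fun i _ => (hdiff i x hx).const_mul (w i))
      (sum_smul_mem_subdiff _ hw0 hh) (fun z hz => ?_) hy
    -- At `x` the weighted sum is at most `Opt`, and on `X` it is at least `Opt`: hence `x`
    -- minimises it.
    exact ((sum_mul_le_ciSup hw0 hw1).trans hopt.le).trans (hwle z hz)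
  set Y : Ξ → ℝ := fun ξ => ∑ i, w i * (expect P F i x - F i x ξ) with hYdef
  set D : Ξ → E := fun ξ => ∑ i, w i • (G i ξ - ∫ ξ, G i ξ ∂P) with hDdef
  have hYm : Measurable Y := Finset.measurable_sum _ fun i _ =>
    ((hFmeas i x).const_sub _).const_mul _
  have hYt : ∀ i, Integrable (fun ξ => w i * (expect P F i x - F i x ξ)) P := fun i =>
    ((integrable_const _).sub (hFint i x)).const_mul _
  have hYi : Integrable Y P := integrable_finsetSum _ fun i _ => hYt i
  have hY0 : ∫ ξ, Y ξ ∂P = 0 := by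
    rw [hYdef, integral_finsetSum _ fun i _ => hYt i]
    refine Finset.sum_eq_zero fun i _ => ?_
    rw [integral_const_mul, integral_sub (integrable_const _) (hFint i x)]
    simp [expect]
  have hYexp : ∫⁻ ξ, ENNReal.ofReal (Real.exp (Y ξ ^ 2 / M₁ ^ 2)) ∂P
      ≤ ENNReal.ofReal (Real.exp 1) := by
    refine lintegral_exp_sq_sum_le P hw0 hw1 (fun i => (hFmeas i x).const_sub _) fun i => ?_
    simpa only [← neg_sub (F i x _), neg_sq] using hexp₁ i x hx
  have hDm : Measurable D := Finset.measurable_sum _ fun i _ =>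
    ((hGm i).sub_const _).const_smul _
  have hDt : ∀ i, Integrable (fun ξ => w i • (G i ξ - ∫ ξ, G i ξ ∂P)) P := fun i =>
    ((hGi i).sub (integrable_const _)).smul _
  have hDi : Integrable D P := integrable_finsetSum _ fun i _ => hDt i
  have hD0 : ∫ ξ, D ξ ∂P = 0 := by
    rw [hDdef, integral_finsetSum _ fun i _ => hDt i]
    refine Finset.sum_eq_zero fun i _ => ?_
    rw [integral_smul, integral_sub (hGi i) (integrable_const _)]
    simp
  have hDexp : ∫⁻ ξ, ENNReal.ofReal (Real.exp (dualNorm p (D ξ) ^ 2 / M₂ ^ 2)) ∂P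
      ≤ ENNReal.ofReal (Real.exp 1) := by
    -- Monotonicity of the lower integral requires no measurability of `subgradDev`.
    refine le_trans (lintegral_mono fun ξ => ENNReal.ofReal_le_ofReal (Real.exp_le_exp.2 ?_))
      (hexp₂ x hx)
    have h1 : dualNorm p (D ξ) ≤ subgradDev p P F x ξ := by
      refine (dualNorm_sum_le hp _ w hw0 _).trans ?_
      calc ∑ i, w i * dualNorm p (G i ξ - ∫ ξ, G i ξ ∂P)
          ≤ ∑ i, w i * subgradDev p P F x ξ := Finset.sum_le_sum fun i _ =>
            mul_le_mul_of_nonneg_left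
              (dualNorm_sub_le_subgradDev hp hFconv hFint (hG i ξ) (hh i)) (hw0 i)
        _ = subgradDev p P F x ξ := by rw [← Finset.sum_mul, hw1, one_mul]
    have h2 := dualNorm_nonneg hp (D ξ)
    gcongr
  set K := bigOmega p ω / 2 * (1 + s ^ 2) + lam with hK
  have hsub : {ξ : Fin N → Ξ | minimaxValue X (sampleAvg F ξ) < minimaxValue X (expect P F)
        - (μ * M₁ + 2 * M₂ * circumradius p X * K) / Real.sqrt N} ⊆
      {ξ | μ * M₁ * Real.sqrt N ≤ ∑ t, Y (ξ t)} ∪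
        {ξ | M₂ * Real.sqrt N * K < dualNorm p (∑ t, D (ξ t))} := by
    intro ξ hξ
    by_contra hcon
    simp only [mem_union, mem_ofPred_eq, not_or, not_le, not_lt] at hcon hξ
    refine absurd hξ (not_lt.2 (le_minimaxValue hXne fun y hy => ?_))
    refine le_trans ?_ (sum_mul_le_ciSup hw0 hw1)
    -- The aggregated subgradient inequality at `x`, with value and subgradient each split into mean
    -- and noise.
    have hterm : ∀ t, ∑ i, w i * expect P F i x - Y (ξ t)
        + inner ℝ (∑ i, w i • ∫ ξ, G i ξ ∂P) (y - x) + inner ℝ (D (ξ t)) (y - x)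
        ≤ ∑ i, w i * F i y (ξ t) := by
      intro t
      have h1 := sum_smul_mem_subdiff Finset.univ hw0 (fun i => hG i (ξ t)) y
      have h2 : ∑ i, w i • G i (ξ t) = ∑ i, (w i • ∫ ξ, G i ξ ∂P) + D (ξ t) := by
        simp only [hDdef, smul_sub, Finset.sum_sub_distrib, add_sub_cancel]
      have h3 : ∑ i, w i * F i x (ξ t) = ∑ i, w i * expect P F i x - Y (ξ t) := by
        simp only [hYdef, mul_sub, Finset.sum_sub_distrib, sub_sub_cancel]
      simp only [h2, h3, inner_add_left] at h1
      linarith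
    have hsum : (N : ℝ) * minimaxValue X (expect P F) - ∑ t, Y (ξ t)
        + inner ℝ (∑ t, D (ξ t)) (y - x) ≤ ∑ t, ∑ i, w i * F i y (ξ t) := by
      calc _ ≤ ∑ t, (∑ i, w i * expect P F i x - Y (ξ t)
            + inner ℝ (∑ i, w i • ∫ ξ, G i ξ ∂P) (y - x) + inner ℝ (D (ξ t)) (y - x)) := by
            rw [Finset.sum_add_distrib, Finset.sum_add_distrib, Finset.sum_sub_distrib, sum_inner]
            simp only [Finset.sum_const, Finset.card_univ, Fintype.card_fin, nsmul_eq_mul]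
            have h1 := mul_le_mul_of_nonneg_left (hwle x hx) hN0.le
            have h2 := mul_nonneg hN0.le (hfirst y hy)
            linarith
        _ ≤ _ := Finset.sum_le_sum fun t _ => hterm t
    have hin : -(2 * circumradius p X * (M₂ * Real.sqrt N * K))
        ≤ inner ℝ (∑ t, D (ξ t)) (y - x) := by
      have h1 := inner_le_mul_dualNorm hp (x - y) (∑ t, D (ξ t))
      have h2 := seminorm_sub_le_two_mul_circumradius p hXcomp hx hy
      have h3 := mul_le_mul h2 hcon.2 (dualNorm_nonneg hp _) ((apply_nonneg p _).trans h2)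
      rw [real_inner_comm, ← neg_sub y x, inner_neg_right, neg_sub] at h1
      linarith
    have havg : ∑ i, w i * sampleAvg F ξ i y = (∑ t, ∑ i, w i * F i y (ξ t)) / N := by
      simp only [sampleAvg]
      rw [Finset.sum_comm, Finset.sum_div]
      refine Finset.sum_congr rfl fun i _ => ?_
      rw [← Finset.mul_sum]
      ring
    rw [havg, le_div_iff₀ hN0]
    have hscale : (μ * M₁ + 2 * M₂ * circumradius p X * K) / Real.sqrt N * N
        = (μ * M₁ + 2 * M₂ * circumradius p X * K) * Real.sqrt N := by
      rw [div_mul_eq_mul_div, mul_div_assoc, Real.div_sqrt]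
    rw [sub_mul, hscale]
    linarith [hcon.1]
  refine (measure_mono hsub).trans ((measure_union_le _ _).trans ?_)
  rw [ENNReal.ofReal_add (by positivity) (by positivity),
    ENNReal.ofReal_add (by positivity) (by positivity)]
  exact add_le_add (measure_sum_ge_le P hYm hYi hY0 hM₁ hYexp hN hμ)
    (hω.measure_dualNorm_sum_gt_le hp P hDm hDi hD0 hM₂ hDexp hN s hlam)

end Deviations

end MinimaxSAA

/-! ### Transfer to an arbitrary i.i.d. sample. -/

theorem proposition5
    {E : Type*} [NormedAddCommGroup E] [InnerProductSpace ℝ E] [FiniteDimensional ℝ E]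
    [MeasurableSpace E] [BorelSpace E]
    -- the norm on `E` and its distance-generating function
    (p : Seminorm ℝ E) (hp : ∀ x, p x = 0 → x = 0)
    (ω : E → ℝ) (hω : MinimaxSAA.IsDistGen p ω)
    (X : Set E) (hXne : X.Nonempty) (hXconv : Convex ℝ X) (hXcomp : IsCompact X)
    {Ξ : Type*} [MeasurableSpace Ξ] (P : Measure Ξ) [IsProbabilityMeasure P]
    {m : ℕ} (hm : 1 ≤ m) (F : Fin m → E → Ξ → ℝ)
    (hFmeas : ∀ i, Measurable (fun z : E × Ξ => F i z.1 z.2))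
    (hFconv : ∀ i ξ, ConvexOn ℝ Set.univ (fun x => F i x ξ))
    (hFint : ∀ i x, Integrable (F i x) P)
    (hdiff : ∀ i, ∀ x ∈ X, DifferentiableAt ℝ (MinimaxSAA.expect P F i) x)
    (M₁ M₂ : ℝ) (hM₁ : 0 < M₁) (hM₂ : 0 < M₂)
    (hexp₁ : ∀ i, ∀ x ∈ X,
      ∫⁻ ξ, ENNReal.ofReal
        (Real.exp ((F i x ξ - MinimaxSAA.expect P F i x) ^ 2 / M₁ ^ 2)) ∂P
          ≤ ENNReal.ofReal (Real.exp 1))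
    (hexp₂ : ∀ x ∈ X,
      ∫⁻ ξ, ENNReal.ofReal
        (Real.exp (MinimaxSAA.subgradDev p P F x ξ ^ 2 / M₂ ^ 2)) ∂P
          ≤ ENNReal.ofReal (Real.exp 1))
    -- an i.i.d. sample of size `N` from `P` on some probability space `(S, Q)`
    {N : ℕ} (hN : 1 ≤ N)
    {S : Type*} [MeasurableSpace S] (Q : Measure S) [IsProbabilityMeasure Q]
    (sample : Fin N → S → Ξ) (hlaw : ∀ t, HasLaw (sample t) P Q) (hindep : iIndepFun sample Q)
    (s : ℝ) (hs : 1 < s)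
    (lam : ℝ) (hlam : lam ∈ Set.Icc 0 (2 * Real.sqrt (MinimaxSAA.tauStar * N)))
    (μ : ℝ) (hμ : μ ∈ Set.Icc 0 (2 * Real.sqrt (MinimaxSAA.tauStar * N))) :
    Q.real {a | MinimaxSAA.minimaxValue X (MinimaxSAA.sampleAvg F (fun t => sample t a))
        > MinimaxSAA.minimaxValue X (MinimaxSAA.expect P F) + μ * M₁ / Real.sqrt N}
      ≤ m * Real.exp (-(μ ^ 2 / (4 * MinimaxSAA.tauStar)))
    ∧
    Q.real {a | MinimaxSAA.minimaxValue X (MinimaxSAA.sampleAvg F (fun t => sample t a))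
        < MinimaxSAA.minimaxValue X (MinimaxSAA.expect P F)
          - (μ * M₁ + 2 * M₂ * MinimaxSAA.circumradius p X
              * (MinimaxSAA.bigOmega p ω / 2 * (1 + s ^ 2) + 2 * lam)) / Real.sqrt N}
      ≤ Real.exp (-(μ ^ 2 / (4 * MinimaxSAA.tauStar)))
        + 2 * (Real.exp (-(N * (s ^ 2 - 1)))
            + Real.exp (-(lam ^ 2 / (4 * MinimaxSAA.tauStar)))) := by
  have : NeZero m := ⟨by omega⟩
  have hN0 : (0 : ℝ) < N := by exact_mod_cast hN
  have hFm : ∀ i x, Measurable (F i x) := fun i x =>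
    (hFmeas i).comp (measurable_const.prodMk measurable_id)
  constructor
  · refine ENNReal.toReal_le_of_le_ofReal (by positivity) ?_
    exact (MinimaxSAA.measure_sample_mem_le hlaw hindep _).trans
      (MinimaxSAA.measure_minimaxValue_sampleAvg_gt_le hXne hXcomp hFm hFconv hFint hM₁ hexp₁ hN hμ)
  · refine ENNReal.toReal_le_of_le_ofReal (by positivity) ?_
    have hR : 0 ≤ MinimaxSAA.circumradius p X := Real.sInf_nonneg fun _ h => h.1
    -- The bound is available with `lam` in place of `2 * lam` and without the factor `2` on the
    -- right; both are weakened here.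
    have hsub : {a | MinimaxSAA.minimaxValue X (MinimaxSAA.sampleAvg F (fun t => sample t a))
        < MinimaxSAA.minimaxValue X (MinimaxSAA.expect P F)
          - (μ * M₁ + 2 * M₂ * MinimaxSAA.circumradius p X
              * (MinimaxSAA.bigOmega p ω / 2 * (1 + s ^ 2) + 2 * lam)) / Real.sqrt N} ⊆
        {a | (fun t => sample t a) ∈ {ξ | MinimaxSAA.minimaxValue X (MinimaxSAA.sampleAvg F ξ)
          < MinimaxSAA.minimaxValue X (MinimaxSAA.expect P F)
          - (μ * M₁ + 2 * M₂ * MinimaxSAA.circumradius p X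
              * (MinimaxSAA.bigOmega p ω / 2 * (1 + s ^ 2) + lam)) / Real.sqrt N}} := by
      intro a ha
      refine lt_of_lt_of_le (mem_ofPred.1 ha) (sub_le_sub_left ?_ _)
      have hlam0 := hlam.1
      gcongr
      linarith
    refine (measure_mono hsub).trans ((MinimaxSAA.measure_sample_mem_le hlaw hindep _).trans
      ((MinimaxSAA.measure_minimaxValue_sampleAvg_lt_le hp hω hXne hXconv hXcomp hFm hFconv hFint
        hdiff hM₁ hM₂ hexp₁ hexp₂ hN s hlam hμ).trans (ENNReal.ofReal_le_ofReal ?_)))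
    have h1 := Real.exp_pos (-((N : ℝ) * (s ^ 2 - 1)))
    have h2 := Real.exp_pos (-(lam ^ 2 / (4 * MinimaxSAA.tauStar)))
    linarith
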